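/- Let $k$ be a field, $S=k[x_1,\ldots,x_n]$, and let $M\subseteq S$ be a monomial ideal minimally generated by monomials $m_1,\ldots,m_r$. Let $\mathbf{T}$ be the Taylor resolution of $S/M$: its multigraded basis consists of all subsets $A\subseteq\{1,\ldots,r\}$ (including $\emptyset$), where $A$ has homological degree $|A|$ and multidegree $\mathrm{mdeg}(A)=\mathrm{lcm}(m_i\mid i\in A)$, with differential $d(A)=\sum_{i\in A}(-1)^{|\{j\in A\,:\,j<i\}|}\frac{\mathrm{mdeg}(A)}{\mathrm{mdeg}(A\setminus\{i\})}\,(A\setminus\{i\})$. A submodule $N\subseteq\mathbf{T}$ is called a Taylor submodule for $M$ if there are a minimal multigraded free resolution $\mathbf{F}$ of $S/M$ and a trivial complex $\mathcal{E}$ (a finite direct sum of shifted complexes $0\to S(-m)\xrightarrow{1}S(-m)\to 0$), each with a fixed multigraded basis, and a change of the multigraded basis of $\mathbf{T}$ under which $\mathbf{T}$ becomes $\mathbf{F}\oplus\mathcal{E}$ (equivalently, an isomorphism $\varphi:\mathbf{T}\to\mathbf{F}\oplus\mathcal{E}$ of complexes of multigraded free $S$-modules), such that $N$ is generated by the new basis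 elements that correspond to the basis of $\mathbf{F}$ (that is, $N=\varphi^{-1}(\mathbf{F})$). Let $\Sigma_M$ be the set of all Taylor submodules for $M$, over all such $\mathbf{F}$, $\mathcal{E}$ and $\varphi$. Let $L_M=\{\mathrm{mdeg}(A)\mid A\subseteq\{1,\ldots,r\}\}$ be the lcm-lattice, and for $m\in L_M$ let $A_m=\{i\mid m_i \text{ divides } m\}$. Call $m\in L_M$ a Scarf multidegree if there is exactly one $A\subseteq\{1,\ldots,r\}$ with $\mathrm{mdeg}(A)=m$. Let $\Omega_M=\{A_m\mid m\in L_M\text{ is a Scarf multidegree}\}$ be the Scarf complex of $M$, and let $\mathbf{T}|_{\Omega_M}$ be the $S$-submodule of $\mathbf{T}$ generated by the basis elements $A\in\Omega_M$. Then $\mathbf{T}|_{\Omega_M}$ is a subcomplex of $\mathbf{T}$, i.e. $d(\mathbf{T}|_{\Omega_M})\subseteq\mathbf{T}|_{\Omega_M}$, and $$\bigcap_{N\in\Sigma_M}N=\mathbf{T}|_{\Omega_M}.$$ -/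

import Mathlib

namespace MonomialResolution

open MvPolynomial

/-- A (finite) complex of multigraded free modules over `S = k[x_1, …, x_n]` with a fixed
multigraded basis. The basis is indexed by the finite type `ι`; the basis element `j` sits in
homological degree `hdeg j` and has multidegree `x ^ mdeg j`. The underlying module is the direct
sum of all the homological components, realised as `ι →₀ S`, and the differential `d` lowers the
homological degree by one and preserves multidegrees. -/
structure MGComplex (k : Type*) [Field k] (n : ℕ) where
  ι : Type
  finite_ι : Finite ι
  hdeg : ι → ℕ
  mdeg : ι → (Fin n →₀ ℕ)
  d : (ι →₀ MvPolynomial (Fin n) k) →ₗ[MvPolynomial (Fin n) k] (ι →₀ MvPolynomial (Fin n) k)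
  d_homogeneous : ∀ j i, ∀ v ∈ (d (Finsupp.single j 1) i).support,
    hdeg i + 1 = hdeg j ∧ v + mdeg i = mdeg j
  d_comp_d : d ∘ₗ d = 0

namespace MGComplex

variable {k : Type*} [Field k] {n : ℕ}

/-- The underlying free `S`-module of a complex, the direct sum of all `F_i`. -/
abbrev Mod (F : MGComplex k n) : Type _ := F.ι →₀ MvPolynomial (Fin n) k

/-- The basis element of `F` with index `j`. -/
noncomputable def basisElt (F : MGComplex k n) (j : F.ι) : F.Mod := Finsupp.single j 1

/-- `x` is multigraded of multidegree `x ^ u` (the zero element is multigraded of every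
multidegree): every monomial `x ^ v` in the coefficient of the basis element `i` satisfies
`x ^ v * mdeg i = x ^ u`. -/
def IsMultigraded (F : MGComplex k n) (u : Fin n →₀ ℕ) (x : F.Mod) : Prop :=
  ∀ i, ∀ v ∈ (x i).support, v + F.mdeg i = u

/-- The component `F_i` of homological degree `i`. -/
noncomputable def component (F : MGComplex k n) (i : ℕ) : Submodule (MvPolynomial (Fin n) k) F.Mod :=
  Finsupp.supported _ _ {j | F.hdeg j = i}

/-- The free submodule `F|_s` generated by the basis elements with index in `s`. -/
noncomputable def restrict (F : MGComplex k n) (s : Set F.ι) : Submodule (MvPolynomial (Fin n) k) F.Mod :=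
  Submodule.span _ (F.basisElt '' s)

/-- `F|_s` is a subcomplex of `F`: it is mapped to itself by the differential. -/
def IsSubcomplex (F : MGComplex k n) (s : Set F.ι) : Prop :=
  ∀ x ∈ F.restrict s, F.d x ∈ F.restrict s

/-- An isomorphism of complexes of multigraded free modules: an `S`-linear isomorphism that
preserves homological degree and multidegree and commutes with the differentials. -/
structure Iso (F G : MGComplex k n) where
  toEquiv : F.Mod ≃ₗ[MvPolynomial (Fin n) k] G.Mod
  mem_component : ∀ j, toEquiv (F.basisElt j) ∈ G.component (F.hdeg j)
  isMultigraded : ∀ j, G.IsMultigraded (F.mdeg j) (toEquiv (F.basisElt j))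
  comm : ∀ x, toEquiv (F.d x) = G.d (toEquiv x)

/-- The direct sum of two complexes; its basis is the disjoint union of the two bases. -/
noncomputable def directSum (F G : MGComplex k n) : MGComplex k n where
  ι := F.ι ⊕ G.ι
  finite_ι := by
    have := F.finite_ι
    have := G.finite_ι
    infer_instance
  hdeg := Sum.elim F.hdeg G.hdeg
  mdeg := Sum.elim F.mdeg G.mdeg
  d := (Finsupp.sumFinsuppLEquivProdFinsupp (MvPolynomial (Fin n) k)).symm.toLinearMap ∘ₗ
    (F.d.prodMap G.d) ∘ₗ
      (Finsupp.sumFinsuppLEquivProdFinsupp (MvPolynomial (Fin n) k)).toLinearMap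
  d_homogeneous := by
    have hl : ∀ j : F.ι, Finsupp.sumFinsuppLEquivProdFinsupp (MvPolynomial (Fin n) k)
        (Finsupp.single (Sum.inl j : F.ι ⊕ G.ι) (1 : MvPolynomial (Fin n) k))
          = (Finsupp.single j 1, 0) := by
      intro j
      ext i : 2 <;> simp [Finsupp.sumFinsuppLEquivProdFinsupp]
    have hr : ∀ j : G.ι, Finsupp.sumFinsuppLEquivProdFinsupp (MvPolynomial (Fin n) k)
        (Finsupp.single (Sum.inr j : F.ι ⊕ G.ι) (1 : MvPolynomial (Fin n) k))
          = (0, Finsupp.single j 1) := by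
      intro j
      ext i : 2 <;> simp [Finsupp.sumFinsuppLEquivProdFinsupp]
    rintro (j | j) (i | i) v hv
    · simp only [LinearMap.comp_apply, LinearEquiv.coe_coe, hl, LinearMap.prodMap_apply] at hv
      exact F.d_homogeneous j i v (by simpa [Finsupp.sumFinsuppLEquivProdFinsupp] using hv)
    · simp only [LinearMap.comp_apply, LinearEquiv.coe_coe, hl, LinearMap.prodMap_apply] at hv
      simp [Finsupp.sumFinsuppLEquivProdFinsupp] at hv
    · simp only [LinearMap.comp_apply, LinearEquiv.coe_coe, hr, LinearMap.prodMap_apply] at hv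
      simp [Finsupp.sumFinsuppLEquivProdFinsupp] at hv
    · simp only [LinearMap.comp_apply, LinearEquiv.coe_coe, hr, LinearMap.prodMap_apply] at hv
      exact G.d_homogeneous j i v (by simpa [Finsupp.sumFinsuppLEquivProdFinsupp] using hv)
  d_comp_d := by
    have hF : ∀ x, F.d (F.d x) = 0 := fun x => LinearMap.congr_fun F.d_comp_d x
    have hG : ∀ x, G.d (G.d x) = 0 := fun x => LinearMap.congr_fun G.d_comp_d x
    refine LinearMap.ext fun x => ?_
    simp only [LinearMap.comp_apply, LinearEquiv.coe_coe, LinearEquiv.apply_symm_apply,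
      LinearMap.prodMap_apply, hF, hG, LinearMap.zero_apply]
    exact map_zero _

/-- A trivial complex: a direct sum of short trivial complexes `0 → S(-m) → S(-m) → 0` with
differential `1`. The basis splits into pairs `(e (inr a), e (inl a))` with
`d (e (inr a)) = e (inl a)`, where both members of a pair have the same multidegree by
`d_homogeneous`. -/
def IsTrivial (E : MGComplex k n) : Prop :=
  ∃ (κ : Type) (e : κ ⊕ κ ≃ E.ι), ∀ a : κ,
    E.d (E.basisElt (e (Sum.inr a))) = E.basisElt (e (Sum.inl a)) ∧
    E.d (E.basisElt (e (Sum.inl a))) = 0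

/-- `F` is a multigraded free resolution of `S/M`: it is exact in positive homological degrees,
and there is a multigraded surjection `ε : F_0 → S/M` whose kernel is `d(F_1)`. -/
def IsFreeResolution (F : MGComplex k n) (M : Ideal (MvPolynomial (Fin n) k)) : Prop :=
  (∀ i, 1 ≤ i → ∀ x ∈ F.component i, F.d x = 0 → ∃ y ∈ F.component (i + 1), F.d y = x) ∧
  ∃ ε : F.component 0 →ₗ[MvPolynomial (Fin n) k] (MvPolynomial (Fin n) k ⧸ M),
    Function.Surjective ε ∧
    (∀ x, ε x = 0 ↔ ∃ y ∈ F.component 1, F.d y = x) ∧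
    ∀ u, ∀ x : F.component 0, F.IsMultigraded u x →
      ∃ c : k, ε x = Ideal.Quotient.mk M (monomial u c)

/-- `F` is a minimal (multigraded) free resolution of `S/M`: moreover `d(F) ⊆ (x_1, …, x_n) F`. -/
def IsMinimalFreeResolution (F : MGComplex k n) (M : Ideal (MvPolynomial (Fin n) k)) : Prop :=
  F.IsFreeResolution M ∧
  LinearMap.range F.d ≤ Ideal.span (Set.range (X : Fin n → MvPolynomial (Fin n) k)) • ⊤

end MGComplex

variable {n r : ℕ}

/-- `M` is minimally generated by the monomials `m_i = x ^ m i`, `i = 1, …, r`: they generate `M`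
and none of them can be omitted. -/
def MinimallyGenerates {k : Type*} [Field k] (m : Fin r → (Fin n →₀ ℕ))
    (M : Ideal (MvPolynomial (Fin n) k)) : Prop :=
  M = Ideal.span (Set.range fun i => monomial (m i) (1 : k)) ∧
  ∀ i, Ideal.span ((fun j => monomial (m j) (1 : k)) '' {j | j ≠ i}) ≠ M

/-- The (exponent of the) multidegree of a face `A` of the simplex on `{1, …, r}`: the least
common multiple of the `m_i`, `i ∈ A`, that is, the componentwise maximum of the exponents. -/
noncomputable def faceMdeg (m : Fin r → (Fin n →₀ ℕ)) (A : Finset (Fin r)) : Fin n →₀ ℕ := A.sup m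

/-- The incidence sign of the facet `A \ {i}` in the oriented simplex `A`. -/
def faceSign (k : Type*) [Field k] (A : Finset (Fin r)) (i : Fin r) : k :=
  (-1) ^ (A.filter (· < i)).card

/-- The Taylor differential
`d(A) = ∑_{i ∈ A} ± (mdeg A / mdeg (A \ {i})) (A \ {i})`. -/
noncomputable def taylorD (k : Type*) [Field k] (m : Fin r → (Fin n →₀ ℕ)) :
    (Finset (Fin r) →₀ MvPolynomial (Fin n) k) →ₗ[MvPolynomial (Fin n) k]
      (Finset (Fin r) →₀ MvPolynomial (Fin n) k) :=
  Finsupp.linearCombination _ fun A => ∑ i ∈ A,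
    Finsupp.single (A.erase i)
      (monomial (faceMdeg m A - faceMdeg m (A.erase i)) (faceSign k A i))

theorem faceMdeg_erase_le (m : Fin r → (Fin n →₀ ℕ)) (A : Finset (Fin r)) (i : Fin r) :
    faceMdeg m (A.erase i) ≤ faceMdeg m A :=
  Finset.sup_mono (Finset.erase_subset i A)

theorem faceSign_anticomm (k : Type*) [Field k] (A : Finset (Fin r)) {i j : Fin r}
    (hi : i ∈ A) (hij : i < j) :
    faceSign k A i * faceSign k (A.erase i) j + faceSign k A j * faceSign k (A.erase j) i = 0 := by
  have h1 : (A.erase j).filter (· < i) = A.filter (· < i) := by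
    ext l
    simp only [Finset.mem_filter, Finset.mem_erase]
    constructor
    · tauto
    · rintro ⟨h, h'⟩
      exact ⟨⟨(h'.trans hij).ne, h⟩, h'⟩
  have h2 : (A.erase i).filter (· < j) = (A.filter (· < j)).erase i := by
    ext l
    simp only [Finset.mem_filter, Finset.mem_erase]
    tauto
  have h3 : ((A.filter (· < j)).erase i).card + 1 = (A.filter (· < j)).card :=
    Finset.card_erase_add_one (by simp [hi, hij])
  simp only [faceSign, h1, h2, ← h3, pow_succ]
  ring

theorem taylorD_single (k : Type*) [Field k] (m : Fin r → (Fin n →₀ ℕ)) (A : Finset (Fin r))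
    (c : MvPolynomial (Fin n) k) :
    taylorD k m (Finsupp.single A c) = ∑ i ∈ A, Finsupp.single (A.erase i)
      (c * monomial (faceMdeg m A - faceMdeg m (A.erase i)) (faceSign k A i)) := by
  simp [taylorD, Finsupp.linearCombination_single, Finset.smul_sum]

theorem taylorD_comp (k : Type*) [Field k] (m : Fin r → (Fin n →₀ ℕ)) :
    taylorD k m ∘ₗ taylorD k m = 0 := by
  refine Finsupp.lhom_ext' fun A => LinearMap.ext_ring ?_
  simp only [LinearMap.comp_apply, Finsupp.lsingle_apply, LinearMap.zero_apply, taylorD_single,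
    map_sum, one_mul, monomial_mul]
  have key : ∀ i ∈ A, ∀ j ∈ A.erase i,
      faceMdeg m A - faceMdeg m (A.erase i) +
        (faceMdeg m (A.erase i) - faceMdeg m ((A.erase i).erase j)) =
      faceMdeg m A - faceMdeg m ((A.erase i).erase j) := fun i _ j _ =>
    tsub_add_tsub_cancel (faceMdeg_erase_le m A i) (faceMdeg_erase_le m _ j)
  rw [Finset.sum_sigma']
  refine Finset.sum_involution (fun p _ => ⟨p.2, p.1⟩) ?_ ?_ ?_ ?_
  · rintro ⟨i, j⟩ h
    simp only [Finset.mem_sigma, Finset.mem_erase] at h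
    obtain ⟨hi, hji, hj⟩ := h
    dsimp only
    rw [key i hi j (by simp [hji, hj]), key j hj i (by simp [hji.symm, hi]),
      Finset.erase_right_comm (a := j) (b := i), ← Finsupp.single_add, ← map_add]
    have : faceSign k A i * faceSign k (A.erase i) j
        + faceSign k A j * faceSign k (A.erase j) i = 0 := by
      rcases lt_or_gt_of_ne hji with h | h
      · rw [add_comm]
        exact faceSign_anticomm k A hj h
      · exact faceSign_anticomm k A hi h
    rw [this]
    simp
  · rintro ⟨i, j⟩ h _ heq
    simp only [Finset.mem_sigma, Finset.mem_erase] at h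
    simp only [Sigma.mk.injEq] at heq
    exact h.2.1 heq.1
  · rintro ⟨i, j⟩ h
    simp only [Finset.mem_sigma, Finset.mem_erase] at h ⊢
    exact ⟨h.2.2, h.2.1.symm, h.1⟩
  · rintro ⟨i, j⟩ _
    rfl

/-- The Taylor resolution of `S/M`, where `M` is generated by the monomials `x ^ m i`. Its basis
consists of all faces `A` (including `∅`) of the simplex on `{1, …, r}`, where `A` has homological
degree `|A|` and multidegree `lcm (m_i | i ∈ A)`. -/
@[reducible] noncomputable def taylor (k : Type*) [Field k] (m : Fin r → (Fin n →₀ ℕ)) : MGComplex k n where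
  ι := Finset (Fin r)
  finite_ι := inferInstance
  hdeg := Finset.card
  mdeg := faceMdeg m
  d := taylorD k m
  d_homogeneous := by
    intro A B v hv
    rw [taylorD_single, Finsupp.finsetSum_apply] at hv
    obtain ⟨i, hi, hw⟩ := Finset.mem_biUnion.1 (MvPolynomial.support_sum hv)
    rw [Finsupp.single_apply] at hw
    split_ifs at hw with h
    · subst h
      rw [one_mul] at hw
      have := Finset.mem_singleton.1 (support_monomial_subset hw)
      subst this
      exact ⟨Finset.card_erase_add_one hi, tsub_add_cancel_of_le (faceMdeg_erase_le m A i)⟩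
    · simp at hw
  d_comp_d := taylorD_comp k m

/-- `N` is a Taylor submodule for `M`: there are a minimal free resolution `F` of `S/M`, a trivial
complex `E` and an isomorphism `φ : T ≅ F ⊕ E` of complexes of multigraded free modules (that is,
a change of the multigraded basis of `T` after which `T` becomes `F ⊕ E`: the new basis elements
are the preimages under `φ` of those of `F ⊕ E`), such that `N` is generated by those elements of
the new basis of `T` that belong to `F`. -/
def IsTaylorSubmodule {k : Type*} [Field k] (m : Fin r → (Fin n →₀ ℕ))
    (M : Ideal (MvPolynomial (Fin n) k))
    (N : Submodule (MvPolynomial (Fin n) k) (taylor k m).Mod) : Prop :=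
  ∃ (F E : MGComplex k n) (φ : (taylor k m).Iso (F.directSum E)),
    F.IsMinimalFreeResolution M ∧ E.IsTrivial ∧
    N = Submodule.span (MvPolynomial (Fin n) k)
      (Set.range fun j : F.ι => φ.toEquiv.symm ((F.directSum E).basisElt (Sum.inl j)))

/-- The lcm-lattice `L_M`: all least common multiples of subsets of `{m_1, …, m_r}`. -/
def lcmLattice (m : Fin r → (Fin n →₀ ℕ)) : Set (Fin n →₀ ℕ) := Set.range (faceMdeg m)

/-- The label `A_u = {i | m_i divides x ^ u}`. -/
noncomputable def label (m : Fin r → (Fin n →₀ ℕ)) (u : Fin n →₀ ℕ) : Finset (Fin r) :=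
  open Classical in Finset.univ.filter fun i => m i ≤ u

/-- `u ∈ L_M` is a Scarf multidegree: exactly one face has multidegree `u`. -/
def IsScarfMultidegree (m : Fin r → (Fin n →₀ ℕ)) (u : Fin n →₀ ℕ) : Prop :=
  u ∈ lcmLattice m ∧ ∃! A : Finset (Fin r), faceMdeg m A = u

/-- The Scarf complex `Ω_M = {A_u | u ∈ L_M is a Scarf multidegree}`. -/
def scarfComplex (m : Fin r → (Fin n →₀ ℕ)) : Set (Finset (Fin r)) :=
  {A | ∃ u, IsScarfMultidegree m u ∧ A = label m u}

end MonomialResolution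

/-! Both inclusions rest on the multidegrees of the faces.

Scarf faces lie in every Taylor submodule. The basis of the trivial summand `E` comes in pairs of
equal multidegree and adjacent homological degrees. An isomorphism of multigraded free modules is
invertible modulo the variables, so the two degrees of a pair also occur as those of two faces `B`,
`B'`. If their common multidegree divided that of a Scarf face `A`, then `B` would be contained in
`A`, hence be Scarf, and `B' = B` would contradict the different cardinalities. So `E` has no basis
element whose multidegree divides that of `A`, and the image of `A` has no component in `E`
(`basisElt_mem_of_mem_scarfComplex`).

Conversely, let `x` lie in all Taylor submodules and let `B` be a non-Scarf face. If some `i ∉ B`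
has `m i` dividing the multidegree of `B`, then `B` has a unit coefficient in the boundary of `B ∪
{i}`. Cancelling this pair leaves a complement in which every element has coefficient zero at `B`;
minimizing it further gives a Taylor submodule that forces `x B = 0` (`exists_splits_pair`,
`exists_isTaylorSubmodule_apply_eq_zero`). Otherwise some `i ∈ B` can be removed without changing
the multidegree. Taylor submodules are subcomplexes, so the first case applies to `d x` at `B \
{i}`; that coefficient is `± x B`, because the other faces having `B \ {i}` as a facet also fall
under the first case (`sInf_isTaylorSubmodule_le`).

That the minimized summand resolves `S/M` follows from the acyclicity of the Taylor complex and
invariance under removing trivial summands (`taylor_isFreeResolution`, `IsFreeResolution.of_iso`).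
-/

namespace MonomialResolution

open MvPolynomial

/-! ### Bihomogeneous elements and maps of degree zero -/

namespace MGComplex

variable {k : Type*} [Field k] {n : ℕ}

/-- `x` is homogeneous of homological degree `p` and multidegree `u`. -/
def IsHomog (F : MGComplex k n) (p : ℕ) (u : Fin n →₀ ℕ) (x : F.Mod) : Prop :=
  ∀ i, ∀ v ∈ (x i).support, F.hdeg i = p ∧ v + F.mdeg i = u

/-- A linear map of degree zero for both gradings. -/
def IsHomogMap (F G : MGComplex k n)
    (f : F.Mod →ₗ[MvPolynomial (Fin n) k] G.Mod) : Prop :=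
  ∀ j, G.IsHomog (F.hdeg j) (F.mdeg j) (f (F.basisElt j))

theorem IsHomog.zero {F : MGComplex k n} {p u} : F.IsHomog p u 0 := by
  intro i v hv
  simp at hv

theorem IsHomog.add {F : MGComplex k n} {p u} {x y : F.Mod} (hx : F.IsHomog p u x)
    (hy : F.IsHomog p u y) : F.IsHomog p u (x + y) := by
  classical
  intro i v hv
  rcases Finset.mem_union.1 (MvPolynomial.support_add hv) with h | h
  exacts [hx i v h, hy i v h]

theorem IsHomog.smul {F : MGComplex k n} {p u w} {x : F.Mod} (hx : F.IsHomog p u x)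
    {a : MvPolynomial (Fin n) k} (ha : ∀ v ∈ a.support, v + u = w) :
    F.IsHomog p w (a • x) := by
  classical
  intro i v hv
  obtain ⟨v₁, h₁, v₂, h₂, rfl⟩ := Finset.mem_add.1 (MvPolynomial.support_mul _ _ hv)
  obtain ⟨h, h'⟩ := hx i v₂ h₂
  exact ⟨h, by rw [add_assoc, h', ha v₁ h₁]⟩

theorem IsHomog.neg {F : MGComplex k n} {p u} {x : F.Mod} (hx : F.IsHomog p u x) :
    F.IsHomog p u (-x) := by
  intro i v hv
  exact hx i v (by simpa using hv)

theorem isHomog_single {F : MGComplex k n} (i : F.ι) {u : Fin n →₀ ℕ}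
    {a : MvPolynomial (Fin n) k} (ha : ∀ v ∈ a.support, v + F.mdeg i = u) :
    F.IsHomog (F.hdeg i) u (Finsupp.single i a) := by
  classical
  intro l v hv
  rw [Finsupp.single_apply] at hv
  split_ifs at hv with h
  · subst h
    exact ⟨rfl, ha v hv⟩
  · simp at hv

theorem isHomog_basisElt (F : MGComplex k n) (i : F.ι) :
    F.IsHomog (F.hdeg i) (F.mdeg i) (F.basisElt i) :=
  isHomog_single i fun v hv => by
    have : v = 0 := by simpa using support_monomial_subset (s := 0) (a := (1 : k)) hv
    simp [this]

theorem isHomog_single_monomial (F : MGComplex k n) (i : F.ι) (v : Fin n →₀ ℕ) (c : k) :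
    F.IsHomog (F.hdeg i) (v + F.mdeg i) (Finsupp.single i (monomial v c)) :=
  isHomog_single i fun w hw => by
    rw [Finset.mem_singleton.1 (support_monomial_subset hw)]

theorem isHomog_iff {F : MGComplex k n} {p u} {x : F.Mod} :
    F.IsHomog p u x ↔ x ∈ F.component p ∧ F.IsMultigraded u x := by
  constructor
  · intro h
    refine ⟨?_, fun i v hv => (h i v hv).2⟩
    intro i hi
    obtain ⟨v, hv⟩ := MvPolynomial.support_nonempty.2 (Finsupp.mem_support_iff.1 hi)
    exact (h i v hv).1
  · rintro ⟨h, h'⟩ i v hv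
    refine ⟨h (Finsupp.mem_support_iff.2 fun h0 => ?_), h' i v hv⟩
    simp [h0] at hv

theorem single_eq_smul_basisElt (F : MGComplex k n) (i : F.ι) (a : MvPolynomial (Fin n) k) :
    (Finsupp.single i a : F.Mod) = a • F.basisElt i := by
  simp [basisElt]

theorem induction_monomial {F : MGComplex k n} {P : F.Mod → Prop} (x : F.Mod) (zero : P 0)
    (add : ∀ x y, P x → P y → P (x + y))
    (single : ∀ i v c, P (Finsupp.single i (monomial v c))) : P x := by
  induction x using Finsupp.induction_linear with
  | zero => exact zero
  | add f g hf hg => exact add f g hf hg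
  | single i a =>
    induction a using MvPolynomial.induction_on' with
    | monomial v c => exact single i v c
    | add p q hp hq =>
      rw [Finsupp.single_add]
      exact add _ _ hp hq

open Classical in
/-- The projection to the homogeneous component of homological degree `p` and multidegree `u`. -/
noncomputable def homogProj (F : MGComplex k n) (p : ℕ) (u : Fin n →₀ ℕ) : F.Mod →+ F.Mod :=
  Finsupp.liftAddHom fun i => (Finsupp.singleAddHom i).comp
    (if F.hdeg i = p ∧ F.mdeg i ≤ u then
      (monomial (u - F.mdeg i)).toAddMonoidHom.comp (coeffAddMonoidHom (u - F.mdeg i)) else 0)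

open Classical in
theorem homogProj_single (F : MGComplex k n) (p : ℕ) (u : Fin n →₀ ℕ) (i : F.ι)
    (v : Fin n →₀ ℕ) (c : k) :
    F.homogProj p u (Finsupp.single i (monomial v c)) =
      if F.hdeg i = p ∧ v + F.mdeg i = u then Finsupp.single i (monomial v c) else 0 := by
  rw [homogProj, Finsupp.liftAddHom_apply_single]
  split_ifs with h h' h'
  · obtain ⟨-, rfl⟩ := h'
    simp
  · have hv : v ≠ u - F.mdeg i := by
      rintro rfl
      exact h' ⟨h.1, tsub_add_cancel_of_le h.2⟩
    simp [coeff_monomial, hv]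
  · exact absurd ⟨h'.1, by rw [← h'.2]; exact le_add_self⟩ h
  · simp

theorem isHomog_homogProj (F : MGComplex k n) (p : ℕ) (u : Fin n →₀ ℕ) (x : F.Mod) :
    F.IsHomog p u (F.homogProj p u x) := by
  induction x using induction_monomial with
  | zero => simpa using IsHomog.zero
  | add x y hx hy => simpa using hx.add hy
  | single i v c =>
    rw [homogProj_single]
    split_ifs with h
    · have := F.isHomog_single_monomial i v c
      rwa [h.1, h.2] at this
    · exact IsHomog.zero

theorem IsHomog.homogProj_eq {F : MGComplex k n} {p u} {x : F.Mod} (hx : F.IsHomog p u x) :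
    F.homogProj p u x = x := by
  classical
  have key : ∀ i, F.homogProj p u (Finsupp.single i (x i)) = Finsupp.single i (x i) := by
    intro i
    conv_lhs => rw [(x i).as_sum]
    conv_rhs => rw [(x i).as_sum]
    rw [Finsupp.single_finsetSum, map_sum]
    refine Finset.sum_congr rfl fun v hv => ?_
    rw [homogProj_single, if_pos (hx i v hv)]
  conv_lhs => rw [← Finsupp.sum_single x]
  conv_rhs => rw [← Finsupp.sum_single x]
  rw [Finsupp.sum, map_sum]
  exact Finset.sum_congr rfl fun i _ => key i

theorem IsHomog.homogProj_of_ne {F : MGComplex k n} {p u q w} {x : F.Mod}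
    (hx : F.IsHomog p u x) (h : ¬ (p = q ∧ u = w)) : F.homogProj q w x = 0 := by
  classical
  have key : ∀ i, F.homogProj q w (Finsupp.single i (x i)) = 0 := by
    intro i
    rw [(x i).as_sum, Finsupp.single_finsetSum, map_sum]
    refine Finset.sum_eq_zero fun v hv => ?_
    obtain ⟨h₁, h₂⟩ := hx i v hv
    rw [homogProj_single, if_neg]
    rwa [h₁, h₂]
  conv_lhs => rw [← Finsupp.sum_single x]
  rw [Finsupp.sum, map_sum]
  exact Finset.sum_eq_zero fun i _ => key i

/-- Degree zero is imposed on basis elements only; commuting with the projections carries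
homogeneity to all elements and to inverse maps. -/
theorem IsHomogMap.homogProj_comm {F G : MGComplex k n}
    {f : F.Mod →ₗ[MvPolynomial (Fin n) k] G.Mod} (hf : F.IsHomogMap G f) (p : ℕ)
    (u : Fin n →₀ ℕ) (x : F.Mod) : G.homogProj p u (f x) = f (F.homogProj p u x) := by
  classical
  induction x using induction_monomial with
  | zero => simp
  | add x y hx hy => simp [hx, hy]
  | single i v c =>
    have h : G.IsHomog (F.hdeg i) (v + F.mdeg i) (f (Finsupp.single i (monomial v c))) := by
      rw [single_eq_smul_basisElt, map_smul]
      refine (hf i).smul fun w hw => ?_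
      rw [Finset.mem_singleton.1 (support_monomial_subset hw)]
    rw [homogProj_single]
    split_ifs with h'
    · rw [h'.1, h'.2] at h
      exact h.homogProj_eq
    · rw [map_zero]
      exact h.homogProj_of_ne h'

theorem IsHomogMap.isHomog {F G : MGComplex k n}
    {f : F.Mod →ₗ[MvPolynomial (Fin n) k] G.Mod} (hf : F.IsHomogMap G f) {p u} {x : F.Mod}
    (hx : F.IsHomog p u x) : G.IsHomog p u (f x) := by
  rw [← hx.homogProj_eq, ← hf.homogProj_comm]
  exact isHomog_homogProj _ _ _ _

theorem IsHomogMap.comp {F G H : MGComplex k n}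
    {f : F.Mod →ₗ[MvPolynomial (Fin n) k] G.Mod} {g : G.Mod →ₗ[MvPolynomial (Fin n) k] H.Mod}
    (hg : G.IsHomogMap H g) (hf : F.IsHomogMap G f) : F.IsHomogMap H (g ∘ₗ f) :=
  fun j => hg.isHomog (hf j)

/-- Projecting `f (f.symm b) = b` shows that `f.symm b` and its homogeneous projection have the same
image under `f`, so they agree. -/
theorem IsHomogMap.symm {F G : MGComplex k n} {f : F.Mod ≃ₗ[MvPolynomial (Fin n) k] G.Mod}
    (hf : F.IsHomogMap G f.toLinearMap) : G.IsHomogMap F f.symm.toLinearMap := by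
  intro j
  have h := hf.homogProj_comm (G.hdeg j) (G.mdeg j) (f.symm (G.basisElt j))
  simp only [LinearEquiv.coe_coe, LinearEquiv.apply_symm_apply,
    (G.isHomog_basisElt j).homogProj_eq] at h
  rw [LinearEquiv.coe_coe, h, LinearEquiv.symm_apply_apply]
  exact isHomog_homogProj _ _ _ _

theorem component_eq_span (F : MGComplex k n) (p : ℕ) :
    F.component p = F.restrict {j | F.hdeg j = p} :=
  Finsupp.supported_eq_span_single _ _

theorem basisElt_mem_component (F : MGComplex k n) (j : F.ι) :
    F.basisElt j ∈ F.component (F.hdeg j) :=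
  (isHomog_iff.1 (F.isHomog_basisElt j)).1

theorem mem_restrict_iff {F : MGComplex k n} {s : Set F.ι} {x : F.Mod} :
    x ∈ F.restrict s ↔ ∀ j ∉ s, x j = 0 := by
  have : F.restrict s = Finsupp.supported _ _ s :=
    (Finsupp.supported_eq_span_single _ _).symm
  rw [this, Finsupp.mem_supported']

theorem IsHomogMap.mem_component {F G : MGComplex k n}
    {f : F.Mod →ₗ[MvPolynomial (Fin n) k] G.Mod} (hf : F.IsHomogMap G f) {p} {x : F.Mod}
    (hx : x ∈ F.component p) : f x ∈ G.component p := by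
  rw [component_eq_span] at hx
  have : F.restrict {j | F.hdeg j = p} ≤ (G.component p).comap f := by
    refine Submodule.span_le.2 ?_
    rintro _ ⟨j, rfl, rfl⟩
    exact (isHomog_iff.1 (hf j)).1
  exact this hx

theorem Iso.isHomogMap {F G : MGComplex k n} (φ : F.Iso G) :
    F.IsHomogMap G φ.toEquiv.toLinearMap :=
  fun j => isHomog_iff.2 ⟨φ.mem_component j, φ.isMultigraded j⟩

/-! ### Direct sums and splittings -/

/-- The underlying module of a direct sum of complexes is the product of the underlying
modules. -/
noncomputable def sumEquiv (F G : MGComplex k n) :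
    (F.directSum G).Mod ≃ₗ[MvPolynomial (Fin n) k] F.Mod × G.Mod :=
  Finsupp.sumFinsuppLEquivProdFinsupp (MvPolynomial (Fin n) k)

theorem sumEquiv_d (F G : MGComplex k n) (z : (F.directSum G).Mod) :
    F.sumEquiv G ((F.directSum G).d z) =
      (F.d (F.sumEquiv G z).1, G.d (F.sumEquiv G z).2) :=
  (Finsupp.sumFinsuppLEquivProdFinsupp (MvPolynomial (Fin n) k)).apply_symm_apply _

theorem sumEquiv_snd_apply (F G : MGComplex k n) (z : (F.directSum G).Mod) (j : G.ι) :
    (F.sumEquiv G z).2 j = z (Sum.inr j) := rfl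

theorem sumEquiv_basisElt_inl (F G : MGComplex k n) (j : F.ι) :
    F.sumEquiv G ((F.directSum G).basisElt (Sum.inl j)) = (F.basisElt j, 0) := by
  have : Finsupp.sumFinsuppLEquivProdFinsupp (MvPolynomial (Fin n) k)
      (Finsupp.single (Sum.inl j : F.ι ⊕ G.ι) (1 : MvPolynomial (Fin n) k))
        = (Finsupp.single j 1, 0) := by
    ext i : 2 <;> simp [Finsupp.sumFinsuppLEquivProdFinsupp]
  exact this

theorem sumEquiv_basisElt_inr (F G : MGComplex k n) (j : G.ι) :
    F.sumEquiv G ((F.directSum G).basisElt (Sum.inr j)) = (0, G.basisElt j) := by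
  have : Finsupp.sumFinsuppLEquivProdFinsupp (MvPolynomial (Fin n) k)
      (Finsupp.single (Sum.inr j : F.ι ⊕ G.ι) (1 : MvPolynomial (Fin n) k))
        = (0, Finsupp.single j 1) := by
    ext i : 2 <;> simp [Finsupp.sumFinsuppLEquivProdFinsupp]
  exact this

theorem sumEquiv_symm_basisElt_left (F G : MGComplex k n) (j : F.ι) :
    (F.sumEquiv G).symm (F.basisElt j, 0) = (F.directSum G).basisElt (Sum.inl j) := by
  rw [LinearEquiv.symm_apply_eq, sumEquiv_basisElt_inl]

theorem sumEquiv_symm_basisElt_right (F G : MGComplex k n) (j : G.ι) :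
    (F.sumEquiv G).symm (0, G.basisElt j) = (F.directSum G).basisElt (Sum.inr j) := by
  rw [LinearEquiv.symm_apply_eq, sumEquiv_basisElt_inr]

theorem directSum_d_inl (F G : MGComplex k n) (x : F.Mod) :
    (F.directSum G).d ((F.sumEquiv G).symm (x, 0)) = (F.sumEquiv G).symm (F.d x, 0) := by
  rw [LinearEquiv.eq_symm_apply, sumEquiv_d]
  simp

theorem directSum_d_inr (F G : MGComplex k n) (x : G.Mod) :
    (F.directSum G).d ((F.sumEquiv G).symm (0, x)) = (F.sumEquiv G).symm (0, G.d x) := by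
  rw [LinearEquiv.eq_symm_apply, sumEquiv_d]
  simp

theorem IsTrivial.directSum {F G : MGComplex k n} (hF : F.IsTrivial) (hG : G.IsTrivial) :
    (F.directSum G).IsTrivial := by
  obtain ⟨κ, e, he⟩ := hF
  obtain ⟨κ', e', he'⟩ := hG
  refine ⟨κ ⊕ κ', (Equiv.sumSumSumComm κ κ' κ κ').trans (e.sumCongr e'), ?_⟩
  rintro (a | a)
  · change (F.directSum G).d ((F.directSum G).basisElt (Sum.inl (e (Sum.inr a)))) =
        (F.directSum G).basisElt (Sum.inl (e (Sum.inl a))) ∧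
      (F.directSum G).d ((F.directSum G).basisElt (Sum.inl (e (Sum.inl a)))) = 0
    simp only [← sumEquiv_symm_basisElt_left, directSum_d_inl, (he a).1, (he a).2]
    exact ⟨trivial, map_zero _⟩
  · change (F.directSum G).d ((F.directSum G).basisElt (Sum.inr (e' (Sum.inr a)))) =
        (F.directSum G).basisElt (Sum.inr (e' (Sum.inl a))) ∧
      (F.directSum G).d ((F.directSum G).basisElt (Sum.inr (e' (Sum.inl a)))) = 0
    simp only [← sumEquiv_symm_basisElt_right, directSum_d_inr, (he' a).1, (he' a).2]
    exact ⟨trivial, map_zero _⟩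

/-- `G` is the internal direct sum of the images of `F` and `E` under the homogeneous chain maps
`α` and `β`. -/
structure Splits (G F E : MGComplex k n) (α : F.Mod →ₗ[MvPolynomial (Fin n) k] G.Mod)
    (β : E.Mod →ₗ[MvPolynomial (Fin n) k] G.Mod) : Prop where
  homog_left : F.IsHomogMap G α
  homog_right : E.IsHomogMap G β
  comm_left : ∀ x, G.d (α x) = α (F.d x)
  comm_right : ∀ x, G.d (β x) = β (E.d x)
  bijective : Function.Bijective (α.coprod β)

theorem Splits.exists_iso {G F E : MGComplex k n}
    {α : F.Mod →ₗ[MvPolynomial (Fin n) k] G.Mod} {β : E.Mod →ₗ[MvPolynomial (Fin n) k] G.Mod}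
    (h : G.Splits F E α β) : ∃ φ : G.Iso (F.directSum E),
      ∀ j, φ.toEquiv.symm ((F.directSum E).basisElt (Sum.inl j)) = α (F.basisElt j) := by
  let ψ : (F.directSum E).Mod ≃ₗ[MvPolynomial (Fin n) k] G.Mod :=
    (F.sumEquiv E).trans (LinearEquiv.ofBijective _ h.bijective)
  have hψ : ∀ z, ψ z = α (F.sumEquiv E z).1 + β (F.sumEquiv E z).2 := fun z => rfl
  have hl : ∀ j, ψ ((F.directSum E).basisElt (Sum.inl j)) = α (F.basisElt j) := fun j => by
    simp [hψ, sumEquiv_basisElt_inl]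
  have hr : ∀ j, ψ ((F.directSum E).basisElt (Sum.inr j)) = β (E.basisElt j) := fun j => by
    simp [hψ, sumEquiv_basisElt_inr]
  have hom : (F.directSum E).IsHomogMap G ψ.toLinearMap := by
    rintro (j | j)
    · rw [LinearEquiv.coe_coe, hl]
      exact h.homog_left j
    · rw [LinearEquiv.coe_coe, hr]
      exact h.homog_right j
  have hom' := hom.symm
  refine ⟨⟨ψ.symm, fun j => (isHomog_iff.1 (hom' j)).1, fun j => (isHomog_iff.1 (hom' j)).2,
    fun x => ?_⟩, fun j => hl j⟩
  rw [LinearEquiv.symm_apply_eq, hψ, sumEquiv_d, ← h.comm_left, ← h.comm_right, ← map_add, ← hψ,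
    LinearEquiv.apply_symm_apply]

theorem Splits.trans {G F E F' E' : MGComplex k n}
    {α : F.Mod →ₗ[MvPolynomial (Fin n) k] G.Mod} {β : E.Mod →ₗ[MvPolynomial (Fin n) k] G.Mod}
    {α' : F'.Mod →ₗ[MvPolynomial (Fin n) k] F.Mod}
    {β' : E'.Mod →ₗ[MvPolynomial (Fin n) k] F.Mod}
    (h : G.Splits F E α β) (h' : F.Splits F' E' α' β') :
    G.Splits F' (E.directSum E') (α ∘ₗ α')
      ((β.coprod (α ∘ₗ β')) ∘ₗ (E.sumEquiv E').toLinearMap) where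
  homog_left := h.homog_left.comp h'.homog_left
  homog_right := by
    rintro (j | j)
    · rw [LinearMap.comp_apply, LinearEquiv.coe_coe, sumEquiv_basisElt_inl]
      simp only [LinearMap.coprod_apply, map_zero, add_zero]
      exact h.homog_right j
    · rw [LinearMap.comp_apply, LinearEquiv.coe_coe, sumEquiv_basisElt_inr]
      simp only [LinearMap.coprod_apply, map_zero, zero_add]
      exact (h.homog_left.comp h'.homog_right) j
  comm_left x := by simp [h.comm_left, h'.comm_left]
  comm_right x := by
    simp [h.comm_left, h'.comm_right, h.comm_right, sumEquiv_d]
  bijective := by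
    -- The composite map factors through the two given bijections, so its injectivity and
    -- surjectivity reduce to theirs.
    have key : ∀ x z, ((α ∘ₗ α').coprod ((β.coprod (α ∘ₗ β')) ∘ₗ (E.sumEquiv E').toLinearMap))
        (x, z) = (α.coprod β) ((α'.coprod β') (x, (E.sumEquiv E' z).2), (E.sumEquiv E' z).1) := by
      intro x z
      simp only [LinearMap.coprod_apply, LinearMap.comp_apply, LinearEquiv.coe_coe, map_add]
      abel
    constructor
    · rintro ⟨x, z⟩ ⟨y, w⟩ hxy
      rw [key, key] at hxy
      have h₁ := h.bijective.1 hxy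
      rw [Prod.mk.injEq] at h₁
      have h₂ := h'.bijective.1 h₁.1
      rw [Prod.mk.injEq] at h₂
      have h₃ : z = w := (E.sumEquiv E').injective (Prod.ext h₁.2 h₂.2)
      rw [h₂.1, h₃]
    · intro g
      obtain ⟨⟨f, e⟩, rfl⟩ := h.bijective.2 g
      obtain ⟨⟨f', e'⟩, rfl⟩ := h'.bijective.2 f
      refine ⟨(f', (E.sumEquiv E').symm (e, e')), ?_⟩
      rw [key, LinearEquiv.apply_symm_apply]

/-! ### Resolutions after removing a trivial summand -/

theorem IsTrivial.exists_d_eq {E : MGComplex k n} (hE : E.IsTrivial) {x : E.Mod}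
    (hx : x ∈ E.component 0) : ∃ y ∈ E.component 1, E.d y = x := by
  obtain ⟨κ, e, he⟩ := hE
  have hdeg : ∀ a, E.hdeg (e (Sum.inl a)) + 1 = E.hdeg (e (Sum.inr a)) := by
    intro a
    refine (E.d_homogeneous (e (Sum.inr a)) (e (Sum.inl a)) 0 ?_).1
    have := (he a).1
    rw [basisElt] at this
    rw [this]
    simp [basisElt]
  rw [component_eq_span] at hx
  have : E.restrict {j | E.hdeg j = 0} ≤ (E.component 1).map E.d := by
    refine Submodule.span_le.2 ?_
    rintro _ ⟨j, hj, rfl⟩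
    obtain ⟨a | a, rfl⟩ := e.surjective j
    · refine ⟨_, ?_, (he a).1⟩
      have := E.basisElt_mem_component (e (Sum.inr a))
      rwa [← hdeg, show E.hdeg (e (Sum.inl a)) = 0 from hj] at this
    · have h1 : E.hdeg (e (Sum.inr a)) = 0 := hj
      have h2 := hdeg a
      omega
  exact this hx

theorem isHomogMap_inl (F E : MGComplex k n) : F.IsHomogMap (F.directSum E)
    ((F.sumEquiv E).symm.toLinearMap ∘ₗ LinearMap.inl _ _ _) := by
  intro j
  rw [LinearMap.comp_apply, LinearMap.inl_apply, LinearEquiv.coe_coe, sumEquiv_symm_basisElt_left]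
  exact isHomog_basisElt _ _

theorem isHomogMap_inr (F E : MGComplex k n) : E.IsHomogMap (F.directSum E)
    ((F.sumEquiv E).symm.toLinearMap ∘ₗ LinearMap.inr _ _ _) := by
  intro j
  rw [LinearMap.comp_apply, LinearMap.inr_apply, LinearEquiv.coe_coe, sumEquiv_symm_basisElt_right]
  exact isHomog_basisElt _ _

theorem isHomogMap_fst (F E : MGComplex k n) : (F.directSum E).IsHomogMap F
    (LinearMap.fst _ _ _ ∘ₗ (F.sumEquiv E).toLinearMap) := by
  rintro (j | j)
  · rw [LinearMap.comp_apply, LinearEquiv.coe_coe, sumEquiv_basisElt_inl]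
    exact isHomog_basisElt _ _
  · rw [LinearMap.comp_apply, LinearEquiv.coe_coe, sumEquiv_basisElt_inr]
    exact IsHomog.zero

theorem isHomogMap_snd (F E : MGComplex k n) : (F.directSum E).IsHomogMap E
    (LinearMap.snd _ _ _ ∘ₗ (F.sumEquiv E).toLinearMap) := by
  rintro (j | j)
  · rw [LinearMap.comp_apply, LinearEquiv.coe_coe, sumEquiv_basisElt_inl]
    exact IsHomog.zero
  · rw [LinearMap.comp_apply, LinearEquiv.coe_coe, sumEquiv_basisElt_inr]
    exact isHomog_basisElt _ _

/-- `F` is a retract of `G` by the chain maps `α` and `ρ`, so cycles and boundaries transfer.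
Triviality of `E` matters only for the augmentation: the degree zero part of `E` consists of
boundaries, which `ε` kills. -/
theorem IsFreeResolution.of_iso {G F E : MGComplex k n} (φ : G.Iso (F.directSum E))
    (hE : E.IsTrivial) {M : Ideal (MvPolynomial (Fin n) k)} (hG : G.IsFreeResolution M) :
    F.IsFreeResolution M := by
  obtain ⟨hex, ε, hsurj, hker, hgr⟩ := hG
  set ρ : G.Mod →ₗ[MvPolynomial (Fin n) k] F.Mod :=
    (LinearMap.fst _ _ _ ∘ₗ (F.sumEquiv E).toLinearMap) ∘ₗ φ.toEquiv.toLinearMap with hρ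
  set α : F.Mod →ₗ[MvPolynomial (Fin n) k] G.Mod := φ.toEquiv.symm.toLinearMap ∘ₗ
    ((F.sumEquiv E).symm.toLinearMap ∘ₗ LinearMap.inl _ _ _) with hα
  have hρ' : G.IsHomogMap F ρ := (isHomogMap_fst F E).comp φ.isHomogMap
  have hα' : F.IsHomogMap G α := φ.isHomogMap.symm.comp (isHomogMap_inl F E)
  have hρα : ∀ x, ρ (α x) = x := fun x => by simp [hρ, hα]
  have dρ : ∀ x, ρ (G.d x) = F.d (ρ x) := fun x => by simp [hρ, φ.comm, sumEquiv_d]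
  have dα : ∀ x, α (F.d x) = G.d (α x) := fun x => by
    apply φ.toEquiv.injective
    simp [hα, φ.comm, directSum_d_inl]
  refine ⟨fun i hi x hx hdx => ?_,
    ε ∘ₗ α.restrict fun x hx => hα'.mem_component hx, ?_, ?_, ?_⟩
  · obtain ⟨y, hy, hyx⟩ := hex i hi (α x) (hα'.mem_component hx) (by rw [← dα, hdx, map_zero])
    exact ⟨ρ y, hρ'.mem_component hy, by rw [← dρ, hyx, hρα]⟩
  · intro s
    obtain ⟨z, rfl⟩ := hsurj s
    refine ⟨⟨ρ z, hρ'.mem_component z.2⟩, ?_⟩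
    set e := (F.sumEquiv E (φ.toEquiv z)).2
    have he : e ∈ E.component 0 :=
      ((isHomogMap_snd F E).comp φ.isHomogMap).mem_component z.2
    obtain ⟨y, hy, hye⟩ := hE.exists_d_eq he
    rw [← sub_eq_zero, LinearMap.comp_apply, ← map_sub, hker]
    -- The difference `α (ρ z) - z` is minus the `E`-component of `z`, and `E.d y = e`.
    refine ⟨-φ.toEquiv.symm ((F.sumEquiv E).symm (0, y)), ?_, ?_⟩
    · exact neg_mem ((φ.isHomogMap.symm.comp (isHomogMap_inr F E)).mem_component hy)
    · apply φ.toEquiv.injective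
      apply (F.sumEquiv E).injective
      rw [map_neg, map_neg, map_neg, φ.comm]
      ext1 <;> simp [hα, hρ, sumEquiv_d, hye, e]
  · intro x
    rw [LinearMap.comp_apply, hker]
    constructor
    · rintro ⟨y, hy, hyx⟩
      refine ⟨ρ y, hρ'.mem_component hy, ?_⟩
      rw [← dρ, hyx]
      exact hρα x
    · rintro ⟨y, hy, hyx⟩
      refine ⟨α y, hα'.mem_component hy, ?_⟩
      rw [← dα, hyx]
      rfl
  · intro u x hx
    exact hgr u _ (isHomog_iff.1 (hα'.isHomog (isHomog_iff.2 ⟨x.2, hx⟩))).2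

/-! ### Cancelling a pair of basis elements with a unit coefficient -/

theorem IsHomog.d_apply {F : MGComplex k n} {p u} {x : F.Mod} (hx : F.IsHomog p u x) :
    ∀ i, ∀ v ∈ (F.d x i).support, F.hdeg i + 1 = p ∧ v + F.mdeg i = u := by
  classical
  intro i v hv
  rw [← Finsupp.sum_single x, Finsupp.sum, map_sum, Finsupp.finsetSum_apply] at hv
  obtain ⟨j, -, hv⟩ := Finset.mem_biUnion.1 (MvPolynomial.support_sum hv)
  rw [single_eq_smul_basisElt, map_smul, Finsupp.smul_apply, smul_eq_mul] at hv
  obtain ⟨v₁, h₁, v₂, h₂, rfl⟩ := Finset.mem_add.1 (MvPolynomial.support_mul _ _ hv)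
  obtain ⟨a, b⟩ := F.d_homogeneous j i v₂ h₂
  obtain ⟨a', b'⟩ := hx j v₁ h₁
  exact ⟨by omega, by rw [add_assoc, b, b']⟩

theorem d_d (F : MGComplex k n) (x : F.Mod) : F.d (F.d x) = 0 :=
  LinearMap.congr_fun F.d_comp_d x

section Pair

variable (G : MGComplex k n) (i j : G.ι) (c : k)

/-- The index set of the complement of a pair of basis elements. -/
abbrev PairCompl : Type := {l : G.ι // l ≠ i ∧ l ≠ j}

/-- The restriction of coordinates to the complement of a pair of basis elements. -/
noncomputable def pairProj : G.Mod →ₗ[MvPolynomial (Fin n) k]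
    (G.PairCompl i j →₀ MvPolynomial (Fin n) k) :=
  Finsupp.lcomapDomain Subtype.val Subtype.val_injective

/-- The basis elements different from the pair `b_j`, `b_i` are corrected by multiples of `b_j` so
that their boundaries have no coefficient at `b_i`. -/
noncomputable def pairLift : (G.PairCompl i j →₀ MvPolynomial (Fin n) k)
    →ₗ[MvPolynomial (Fin n) k] G.Mod :=
  Finsupp.linearCombination _ fun l =>
    G.basisElt l.1 - (C c⁻¹ * G.d (G.basisElt l.1) i) • G.basisElt j

theorem pairLift_single (l : G.PairCompl i j) : G.pairLift i j c (Finsupp.single l 1) =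
    G.basisElt l.1 - (C c⁻¹ * G.d (G.basisElt l.1) i) • G.basisElt j := by
  simp [pairLift]

variable {i j c}

theorem pairLift_apply_val (x : G.PairCompl i j →₀ MvPolynomial (Fin n) k)
    (l : G.PairCompl i j) : G.pairLift i j c x l.1 = x l := by
  suffices h : Finsupp.lapply l.1 ∘ₗ G.pairLift i j c = Finsupp.lapply l from
    LinearMap.congr_fun h x
  refine Finsupp.lhom_ext' fun l' => LinearMap.ext_ring ?_
  simp only [LinearMap.comp_apply, Finsupp.lsingle_apply, pairLift_single, Finsupp.lapply_apply,
    Finsupp.sub_apply, Finsupp.smul_apply, basisElt]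
  rw [Finsupp.single_eq_of_ne (a := j) l.2.2, smul_zero, sub_zero]
  by_cases h : l = l'
  · subst h
    simp
  · rw [Finsupp.single_eq_of_ne h, Finsupp.single_eq_of_ne fun h' => h (Subtype.ext h')]

theorem pairProj_pairLift (x : G.PairCompl i j →₀ MvPolynomial (Fin n) k) :
    G.pairProj i j (G.pairLift i j c x) = x :=
  Finsupp.ext fun l => G.pairLift_apply_val x l

theorem pairLift_apply_left (hij : i ≠ j) (x : G.PairCompl i j →₀ MvPolynomial (Fin n) k) :
    G.pairLift i j c x i = 0 := by
  suffices h : Finsupp.lapply i ∘ₗ G.pairLift i j c = 0 from LinearMap.congr_fun h x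
  refine Finsupp.lhom_ext' fun l' => LinearMap.ext_ring ?_
  simp only [LinearMap.comp_apply, Finsupp.lsingle_apply, pairLift_single, Finsupp.lapply_apply,
    Finsupp.sub_apply, Finsupp.smul_apply, basisElt]
  rw [Finsupp.single_eq_of_ne hij, Finsupp.single_eq_of_ne l'.2.1.symm]
  simp

/-- The multiple of `b_j` in `pairLift` is chosen for this cancellation, as the boundary of `b_j`
has coefficient `c` at `b_i`. -/
theorem d_pairLift_apply_left (hc : G.d (G.basisElt j) i = C c) (hc0 : c ≠ 0)
    (x : G.PairCompl i j →₀ MvPolynomial (Fin n) k) : G.d (G.pairLift i j c x) i = 0 := by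
  suffices h : Finsupp.lapply i ∘ₗ G.d ∘ₗ G.pairLift i j c = 0 from LinearMap.congr_fun h x
  refine Finsupp.lhom_ext' fun l' => LinearMap.ext_ring ?_
  simp only [LinearMap.comp_apply, Finsupp.lsingle_apply, pairLift_single, Finsupp.lapply_apply,
    map_sub, map_smul, hc, smul_eq_mul]
  rw [mul_right_comm, ← C_mul, inv_mul_cancel₀ hc0, C_1, one_mul, sub_self]
  rfl

/-- This identifies the image of `pairLift` with the elements `z` such that `z` and `d z` vanish at
`b_i`, a submodule stable under `d` because `d ∘ d = 0`. The error term `w` is a multiple of `b_j`,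
and `d w` at `b_i` is `c` times its coefficient, which is therefore zero. -/
theorem pairLift_pairProj (hij : i ≠ j) (hc : G.d (G.basisElt j) i = C c) (hc0 : c ≠ 0)
    {z : G.Mod} (hz : z i = 0) (hdz : G.d z i = 0) :
    G.pairLift i j c (G.pairProj i j z) = z := by
  set w := z - G.pairLift i j c (G.pairProj i j z) with hw
  have hl : ∀ l, l ≠ j → w l = 0 := by
    intro l hl
    by_cases h : l = i
    · rw [h, hw, Finsupp.sub_apply, hz, pairLift_apply_left G hij, sub_zero]
    · have := G.pairLift_apply_val (c := c) (G.pairProj i j z) ⟨l, h, hl⟩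
      rw [hw, Finsupp.sub_apply, this]
      exact sub_self _
  have hwj : w = w j • G.basisElt j := by
    ext1 l
    by_cases h : l = j
    · rw [h]
      simp [basisElt]
    · rw [hl l h, basisElt, Finsupp.smul_apply, Finsupp.single_eq_of_ne h, smul_zero]
  have h0 : G.d w i = 0 := by
    rw [hw, map_sub, Finsupp.sub_apply, hdz, d_pairLift_apply_left G hc hc0, sub_zero]
  rw [hwj, map_smul, Finsupp.smul_apply, hc, smul_eq_mul] at h0
  have : w j = 0 := (mul_eq_zero.1 h0).resolve_right fun h => hc0 (C_eq_zero.1 h)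
  rw [this, zero_smul, hw, sub_eq_zero] at hwj
  exact hwj.symm

theorem isHomog_pairLift_single (hdeg : G.hdeg i + 1 = G.hdeg j) (mdeg : G.mdeg i = G.mdeg j)
    (l : G.PairCompl i j) :
    G.IsHomog (G.hdeg l.1) (G.mdeg l.1) (G.pairLift i j c (Finsupp.single l 1)) := by
  rw [pairLift_single, sub_eq_add_neg]
  refine (G.isHomog_basisElt l.1).add (IsHomog.neg ?_)
  rw [← MvPolynomial.smul_eq_C_mul, ← single_eq_smul_basisElt]
  intro l' v hv
  have hv' := hv
  classical
  rw [Finsupp.single_apply] at hv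
  split_ifs at hv with h
  · subst h
    obtain ⟨a, b⟩ := G.d_homogeneous l.1 i v (MvPolynomial.support_smul hv)
    exact ⟨by omega, by rw [← b, mdeg]⟩
  · simp at hv

theorem pairLift_pairProj_d (hij : i ≠ j) (hc : G.d (G.basisElt j) i = C c) (hc0 : c ≠ 0)
    (x : G.PairCompl i j →₀ MvPolynomial (Fin n) k) :
    G.pairLift i j c (G.pairProj i j (G.d (G.pairLift i j c x))) = G.d (G.pairLift i j c x) :=
  G.pairLift_pairProj hij hc hc0 (G.d_pairLift_apply_left hc hc0 x) (by rw [d_d]; rfl)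

/-- The complex that is left when the pair of basis elements `b_j`, `b_i` is split off. -/
noncomputable def pairCompl (hij : i ≠ j) (hdeg : G.hdeg i + 1 = G.hdeg j)
    (mdeg : G.mdeg i = G.mdeg j) (hc : G.d (G.basisElt j) i = C c) (hc0 : c ≠ 0) :
    MGComplex k n where
  ι := G.PairCompl i j
  finite_ι := by
    have := G.finite_ι
    infer_instance
  hdeg l := G.hdeg l.1
  mdeg l := G.mdeg l.1
  d := G.pairProj i j ∘ₗ G.d ∘ₗ G.pairLift i j c
  d_homogeneous l l' v hv := (G.isHomog_pairLift_single hdeg mdeg l).d_apply l'.1 v hv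
  d_comp_d := by
    refine LinearMap.ext fun x => ?_
    simp only [LinearMap.comp_apply, pairLift_pairProj_d G hij hc hc0, d_d, map_zero,
      LinearMap.zero_apply]

/-- The trivial complex on one pair of basis elements. -/
noncomputable def trivialPair (p : ℕ) (u : Fin n →₀ ℕ) : MGComplex k n where
  ι := Unit ⊕ Unit
  finite_ι := inferInstance
  hdeg := Sum.elim (fun _ => p) (fun _ => p + 1)
  mdeg _ := u
  d := Finsupp.linearCombination _ (Sum.elim 0 fun _ => Finsupp.single (Sum.inl ()) 1)
  d_homogeneous := by
    rintro (⟨⟩ | ⟨⟩) (⟨⟩ | ⟨⟩) v hv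
    · simp at hv
    · simp at hv
    · have : v = 0 := by
        have : v ∈ (1 : MvPolynomial (Fin n) k).support := by simpa using hv
        simpa using support_monomial_subset (s := 0) (a := (1 : k)) this
      simp [this]
    · simp at hv
  d_comp_d := by
    refine Finsupp.lhom_ext' fun j => LinearMap.ext_ring ?_
    rcases j with ⟨⟩ | ⟨⟩ <;> simp

theorem trivialPair_isTrivial (p : ℕ) (u : Fin n →₀ ℕ) :
    (trivialPair p u : MGComplex k n).IsTrivial := by
  refine ⟨Unit, Equiv.refl _, fun _ => ⟨?_, ?_⟩⟩
  · change Finsupp.linearCombination (MvPolynomial (Fin n) k)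
      (Sum.elim 0 fun _ => Finsupp.single (Sum.inl ()) 1 : Unit ⊕ Unit → _)
        (Finsupp.single (Sum.inr ()) 1) = Finsupp.single (Sum.inl ()) 1
    simp
  · change Finsupp.linearCombination (MvPolynomial (Fin n) k)
      (Sum.elim 0 fun _ => Finsupp.single (Sum.inl ()) 1 : Unit ⊕ Unit → Unit ⊕ Unit →₀ _)
        (Finsupp.single (Sum.inl ()) 1) = 0
    simp

/-- The trivial summand is spanned by `b_j` and `d b_j`. On it the functionals `z ↦ z i` and `z ↦ (d
z) i` recover the two coefficients up to the unit `c`, while the image of `pairLift` is their common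
kernel; hence a direct sum. The vanishing of `α x i` is recorded since it later removes a prescribed
face from a Taylor submodule. -/
theorem exists_splits_pair (hdeg : G.hdeg i + 1 = G.hdeg j)
    (mdeg : G.mdeg i = G.mdeg j) (hc : G.d (G.basisElt j) i = C c) (hc0 : c ≠ 0) :
    ∃ (F E : MGComplex k n) (α : F.Mod →ₗ[MvPolynomial (Fin n) k] G.Mod)
      (β : E.Mod →ₗ[MvPolynomial (Fin n) k] G.Mod), G.Splits F E α β ∧ E.IsTrivial ∧
      Nat.card F.ι < Nat.card G.ι ∧ ∀ x, α x i = 0 := by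
  have hij : i ≠ j := by
    rintro rfl
    omega
  let E : MGComplex k n := trivialPair (G.hdeg i) (G.mdeg j)
  let β : (Unit ⊕ Unit →₀ MvPolynomial (Fin n) k) →ₗ[MvPolynomial (Fin n) k] G.Mod :=
    Finsupp.linearCombination _ (Sum.elim (fun _ => G.d (G.basisElt j)) fun _ => G.basisElt j)
  have hβ : ∀ x, β x = x (Sum.inl ()) • G.d (G.basisElt j) + x (Sum.inr ()) • G.basisElt j := by
    intro x
    simp [β, Finsupp.linearCombination_apply, Finsupp.sum_fintype]
  have hβi : ∀ x, β x i = x (Sum.inl ()) * C c := fun x => by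
    rw [hβ, Finsupp.add_apply, Finsupp.smul_apply, Finsupp.smul_apply, hc, basisElt,
      Finsupp.single_eq_of_ne hij]
    simp
  have hdβ : ∀ x, G.d (β x) = x (Sum.inr ()) • G.d (G.basisElt j) := fun x => by
    rw [hβ, map_add, map_smul, map_smul, d_d, smul_zero, zero_add]
  have hdβi : ∀ x, G.d (β x) i = x (Sum.inr ()) * C c := fun x => by
    rw [hdβ, Finsupp.smul_apply, hc, smul_eq_mul]
  have hC : (C c : MvPolynomial (Fin n) k) ≠ 0 := fun h => hc0 (C_eq_zero.1 h)
  have hCC : ∀ a : MvPolynomial (Fin n) k, a * C c⁻¹ * C c = a := fun a => by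
    rw [mul_assoc, ← C_mul, inv_mul_cancel₀ hc0, C_1, mul_one]
  have hd : ∀ x, G.d (β x) = β (Finsupp.linearCombination (MvPolynomial (Fin n) k)
      (Sum.elim 0 fun _ => Finsupp.single (Sum.inl ()) 1) x) := fun x => by
    rw [hdβ, hβ]
    simp [Finsupp.linearCombination_apply, Finsupp.sum_fintype]
  have hinj : ∀ x e, G.pairLift i j c x + β e = 0 → x = 0 ∧ e = 0 := by
    intro x e h
    have h₁ : e (Sum.inl ()) = 0 := by
      have := DFunLike.congr_fun h i
      rw [Finsupp.add_apply, G.pairLift_apply_left hij, hβi, zero_add] at this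
      exact (mul_eq_zero.1 this).resolve_right hC
    have h₂ : e (Sum.inr ()) = 0 := by
      have := DFunLike.congr_fun (congrArg G.d h) i
      rw [map_add, map_zero, Finsupp.add_apply, G.d_pairLift_apply_left hc hc0, hdβi,
        zero_add] at this
      exact (mul_eq_zero.1 this).resolve_right hC
    have h₃ : e = 0 := by
      ext1 l
      rcases l with ⟨⟨⟩⟩ | ⟨⟨⟩⟩
      exacts [h₁, h₂]
    rw [h₃, map_zero, add_zero] at h
    exact ⟨by rw [← G.pairProj_pairLift (c := c) x, h, map_zero], h₃⟩
  have hsurj : ∀ z, ∃ x e, G.pairLift i j c x + β e = z := by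
    intro z
    -- These coefficients are forced by requiring `z - β e` and its boundary to vanish at `b_i`.
    let e : Unit ⊕ Unit →₀ MvPolynomial (Fin n) k :=
      Finsupp.single (Sum.inl ()) (z i * C c⁻¹) + Finsupp.single (Sum.inr ()) (G.d z i * C c⁻¹)
    have hl : e (Sum.inl ()) = z i * C c⁻¹ := by simp [e]
    have hr : e (Sum.inr ()) = G.d z i * C c⁻¹ := by simp [e]
    refine ⟨G.pairProj i j (z - β e), e, ?_⟩
    rw [G.pairLift_pairProj hij hc hc0, sub_add_cancel]
    · rw [Finsupp.sub_apply, hβi, hl, hCC, sub_self]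
    · rw [map_sub, Finsupp.sub_apply, hdβi, hr, hCC, sub_self]
  refine ⟨G.pairCompl hij hdeg mdeg hc hc0, E, G.pairLift i j c, β, ⟨?_, ?_, ?_, ?_, ?_, ?_⟩,
    trivialPair_isTrivial _ _, ?_, G.pairLift_apply_left hij⟩
  · exact fun l => G.isHomog_pairLift_single hdeg mdeg l
  · rintro (⟨⟩ | ⟨⟩)
    · change G.IsHomog (G.hdeg i) (G.mdeg j) (β (Finsupp.single (Sum.inl ()) 1))
      rw [hβ]
      intro l v hv
      obtain ⟨a, b⟩ := G.d_homogeneous j l v (by simpa [basisElt] using hv)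
      exact ⟨by omega, b⟩
    · change G.IsHomog (G.hdeg i + 1) (G.mdeg j) (β (Finsupp.single (Sum.inr ()) 1))
      rw [hβ, hdeg]
      simpa using G.isHomog_basisElt j
  · exact fun x => (G.pairLift_pairProj_d hij hc hc0 x).symm
  · exact hd
  · rw [injective_iff_map_eq_zero]
    exact fun z h => Prod.ext (hinj z.1 z.2 h).1 (hinj z.1 z.2 h).2
  · intro z
    obtain ⟨x, e, h⟩ := hsurj z
    exact ⟨(x, e), h⟩
  · have := G.finite_ι
    exact Finite.card_subtype_lt (x := i) (by simp)

end Pair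

/-! ### Reduction to a minimal complex -/

/-- By homogeneity an entry of the differential with nonzero constant term joins basis elements of
equal multidegree, so it has no other term and is a unit. -/
theorem range_d_le_or_exists_unit (G : MGComplex k n) :
    LinearMap.range G.d ≤ Ideal.span (Set.range (X : Fin n → MvPolynomial (Fin n) k)) • ⊤ ∨
    ∃ (i j : G.ι) (c : k), G.hdeg i + 1 = G.hdeg j ∧ G.mdeg i = G.mdeg j ∧
      G.d (G.basisElt j) i = C c ∧ c ≠ 0 := by
  classical
  by_cases h : ∀ j i, (0 : Fin n →₀ ℕ) ∉ (G.d (G.basisElt j) i).support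
  · left
    rintro _ ⟨x, rfl⟩
    rw [← Finsupp.sum_single x, Finsupp.sum, map_sum]
    refine sum_mem fun j _ => ?_
    rw [single_eq_smul_basisElt, map_smul]
    refine Submodule.smul_mem _ _ ?_
    rw [← Finsupp.sum_single (G.d (G.basisElt j)), Finsupp.sum]
    refine sum_mem fun i _ => ?_
    rw [single_eq_smul_basisElt]
    refine Submodule.smul_mem_smul ?_ trivial
    rw [← Set.image_univ, mem_ideal_span_X_image]
    intro v hv
    by_contra! h0
    refine h j i ?_
    convert hv
    ext a
    exact (h0 a trivial).symm
  · right
    push Not at h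
    obtain ⟨j, i, h⟩ := h
    have h' := G.d_homogeneous j i 0 h
    rw [zero_add] at h'
    have hC : G.d (G.basisElt j) i = C (coeff 0 (G.d (G.basisElt j) i)) := by
      ext v
      rw [coeff_C]
      split_ifs with hv
      · rw [hv]
      · by_contra hne
        have := (G.d_homogeneous j i v (mem_support_iff.2 hne)).2
        rw [h'.2] at this
        exact hv (by simpa using this.symm : v = 0).symm
    exact ⟨i, j, _, h'.1, h'.2, hC, mem_support_iff.1 h⟩

theorem splits_self (G : MGComplex k n) : ∃ (E : MGComplex k n)
    (β : E.Mod →ₗ[MvPolynomial (Fin n) k] G.Mod), G.Splits G E LinearMap.id β ∧ E.IsTrivial := by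
  refine ⟨⟨Empty, inferInstance, fun _ => 0, fun _ => 0, 0, fun j => j.elim, by simp⟩, 0,
    ⟨?_, fun j => j.elim, fun x => rfl, fun x => by simp, ?_, ?_⟩, Empty, Equiv.equivOfIsEmpty _ _,
    fun a => a.elim⟩
  · exact fun j => G.isHomog_basisElt j
  · rintro ⟨x, e⟩ ⟨y, e'⟩ h
    have h' : x = y := by simpa using h
    rw [h']
    congr 1
    ext j
    exact j.elim
  · exact fun x => ⟨(x, 0), by simp⟩

/-- Each cancellation of a unit entry lowers the number of basis elements, so the process ends, and
the removed pairs add up to a trivial complex. -/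
theorem exists_splits_minimal (G : MGComplex k n) :
    ∃ (F E : MGComplex k n) (α : F.Mod →ₗ[MvPolynomial (Fin n) k] G.Mod)
      (β : E.Mod →ₗ[MvPolynomial (Fin n) k] G.Mod), G.Splits F E α β ∧ E.IsTrivial ∧
      LinearMap.range F.d ≤ Ideal.span (Set.range (X : Fin n → MvPolynomial (Fin n) k)) • ⊤ := by
  induction hN : Nat.card G.ι using Nat.strong_induction_on generalizing G with
  | _ N ih =>
    rcases G.range_d_le_or_exists_unit with h | ⟨i, j, c, hdeg, mdeg, hc, hc0⟩
    · obtain ⟨E, β, hs, hE⟩ := G.splits_self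
      exact ⟨G, E, _, β, hs, hE, h⟩
    · obtain ⟨F, E, α, β, hs, hE, hlt, -⟩ := G.exists_splits_pair hdeg mdeg hc hc0
      obtain ⟨F', E', α', β', hs', hE', hF'⟩ := ih _ (hN ▸ hlt) F rfl
      exact ⟨F', _, _, _, hs.trans hs', hE.directSum hE', hF'⟩

end MGComplex

/-! ### Acyclicity of the Taylor complex -/

section Taylor

variable {k : Type*} [Field k] {n r : ℕ} (m : Fin r → (Fin n →₀ ℕ))

theorem mem_label {u : Fin n →₀ ℕ} {i : Fin r} : i ∈ label m u ↔ m i ≤ u := by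
  simp [label]

theorem faceMdeg_empty : faceMdeg m ∅ = 0 := Finset.sup_empty.trans bot_eq_zero

theorem faceMdeg_le_iff {u : Fin n →₀ ℕ} {A : Finset (Fin r)} :
    faceMdeg m A ≤ u ↔ A ⊆ label m u := by
  simp only [faceMdeg, Finset.sup_le_iff, Finset.subset_iff, mem_label]

/-- In the coordinates `x ^ (u - mdeg A) A` the part of multidegree `u` is the augmented simplicial
chain complex of the full simplex on `label m u`. -/
theorem taylorD_single_of_le {u : Fin n →₀ ℕ} {A : Finset (Fin r)} (hA : faceMdeg m A ≤ u)
    (c : k) : taylorD k m (Finsupp.single A (monomial (u - faceMdeg m A) c)) =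
      ∑ i ∈ A, faceSign k A i •
        Finsupp.single (A.erase i) (monomial (u - faceMdeg m (A.erase i)) c) := by
  rw [taylorD_single]
  refine Finset.sum_congr rfl fun i _ => ?_
  rw [monomial_mul, tsub_add_tsub_cancel hA (faceMdeg_erase_le m A i), Finsupp.smul_single,
    smul_monomial, smul_eq_mul, mul_comm]

open Classical in
/-- The contracting homotopy of the Taylor resolution: in multidegree `x ^ u` the smallest vertex
`i` with `m_i` dividing `x ^ u` is added to the faces. -/
noncomputable def taylorHomotopy (k : Type*) [Field k] (m : Fin r → (Fin n →₀ ℕ)) :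
    (Finset (Fin r) →₀ MvPolynomial (Fin n) k) →ₗ[k]
      (Finset (Fin r) →₀ MvPolynomial (Fin n) k) :=
  Finsupp.lsum k fun A => (basisMonomials (Fin n) k).constr k fun v =>
    if h : (label m (v + faceMdeg m A)).Nonempty then
      if (label m (v + faceMdeg m A)).min' h ∈ A then 0
      else Finsupp.single (insert ((label m (v + faceMdeg m A)).min' h) A)
        (monomial (v + faceMdeg m A -
          faceMdeg m (insert ((label m (v + faceMdeg m A)).min' h) A)) 1)
    else 0

theorem taylorHomotopy_single_of_le {u : Fin n →₀ ℕ} {A : Finset (Fin r)}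
    (hA : faceMdeg m A ≤ u) (h : (label m u).Nonempty) (c : k) :
    taylorHomotopy k m (Finsupp.single A (monomial (u - faceMdeg m A) c)) =
      if (label m u).min' h ∈ A then 0 else Finsupp.single (insert ((label m u).min' h) A)
        (monomial (u - faceMdeg m (insert ((label m u).min' h) A)) c) := by
  have hc : (monomial (u - faceMdeg m A) c : MvPolynomial (Fin n) k) =
      c • basisMonomials (Fin n) k (u - faceMdeg m A) := by
    rw [coe_basisMonomials, smul_monomial, smul_eq_mul, mul_one]
  rw [taylorHomotopy, Finsupp.lsum_single, hc, map_smul, Module.Basis.constr_basis]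
  simp only [tsub_add_cancel_of_le hA, dif_pos h]
  split_ifs
  · simp
  · rw [Finsupp.smul_single, smul_monomial, smul_eq_mul, mul_one]

theorem faceSign_of_forall_le {A : Finset (Fin r)} {i : Fin r} (h : ∀ j ∈ A, i ≤ j) :
    faceSign k A i = 1 := by
  rw [faceSign, Finset.filter_eq_empty_iff.2 fun j hj => not_lt.2 (h j hj)]
  simp

theorem faceSign_insert {A : Finset (Fin r)} {i j : Fin r} (hi : i ∉ A) (hij : i < j) :
    faceSign k (insert i A) j = - faceSign k A j := by
  rw [faceSign, faceSign, Finset.filter_insert, if_pos hij,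
    Finset.card_insert_of_notMem (by simp [hi]), pow_succ]
  ring

/-- This is the contraction of a simplex as a cone over its vertex `i₀`. Since `i₀` is the smallest
vertex, it carries the sign `1`, and inserting it flips the signs of all others. -/
theorem taylorHomotopy_of_le {u : Fin n →₀ ℕ} {A : Finset (Fin r)}
    (hA : faceMdeg m A ≤ u) (h : (label m u).Nonempty) (c : k) :
    taylorD k m (taylorHomotopy k m (Finsupp.single A (monomial (u - faceMdeg m A) c))) +
      taylorHomotopy k m (taylorD k m (Finsupp.single A (monomial (u - faceMdeg m A) c))) =
        Finsupp.single A (monomial (u - faceMdeg m A) c) := by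
  have hAi : ∀ i, faceMdeg m (A.erase i) ≤ u := fun i => (faceMdeg_erase_le m A i).trans hA
  have hsub := (faceMdeg_le_iff m).1 hA
  rw [taylorD_single_of_le m hA, map_sum]
  simp only [map_smul, taylorHomotopy_single_of_le m hA h,
    taylorHomotopy_single_of_le m (hAi _) h]
  set i₀ := (label m u).min' h with hi₀
  have hle : ∀ j ∈ A, i₀ ≤ j := fun j hj => Finset.min'_le _ _ (hsub hj)
  by_cases hmem : i₀ ∈ A
  · rw [if_pos hmem, map_zero, zero_add, Finset.sum_eq_single_of_mem i₀ hmem]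
    · rw [if_neg (Finset.notMem_erase _ _), Finset.insert_erase hmem, faceSign_of_forall_le hle,
        one_smul]
    · intro j _ hj
      rw [if_pos (Finset.mem_erase.2 ⟨hj.symm, hmem⟩), smul_zero]
  -- Erasing `i₀` from the cone returns `A`; the remaining facets cancel against the cones over the
  -- facets of `A`.
  · have hB : faceMdeg m (insert i₀ A) ≤ u :=
      (faceMdeg_le_iff m).2 (Finset.insert_subset (Finset.min'_mem _ _) hsub)
    have hB' : ∀ j ∈ insert i₀ A, i₀ ≤ j := by
      simpa using hle
    rw [if_neg hmem, taylorD_single_of_le m hB, Finset.sum_insert hmem,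
      faceSign_of_forall_le hB', one_smul, Finset.erase_insert hmem, add_assoc,
      ← Finset.sum_add_distrib, Finset.sum_eq_zero, add_zero]
    intro j hj
    have hne : i₀ ≠ j := fun h => hmem (h ▸ hj)
    rw [if_neg fun h => hmem (Finset.mem_of_mem_erase h), faceSign_insert hmem
      ((hle j hj).lt_of_ne hne), Finset.erase_insert_of_ne hne, neg_smul, neg_add_cancel]

/-- A vertex of `A` guarantees that `label` is nonempty. For the empty face the identity fails in
multidegrees divisible by no `m i`, which is where `S/M` survives. -/
theorem taylorHomotopy_single {A : Finset (Fin r)} (hA : A.Nonempty)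
    (p : MvPolynomial (Fin n) k) :
    taylorD k m (taylorHomotopy k m (Finsupp.single A p)) +
      taylorHomotopy k m (taylorD k m (Finsupp.single A p)) = Finsupp.single A p := by
  induction p using MvPolynomial.induction_on' with
  | monomial v c =>
    obtain ⟨i, hi⟩ := hA
    have h : i ∈ label m (v + faceMdeg m A) :=
      (faceMdeg_le_iff m).1 le_add_self hi
    simpa using taylorHomotopy_of_le m (u := v + faceMdeg m A) le_add_self ⟨i, h⟩ c
  | add p q hp hq =>
    rw [Finsupp.single_add, map_add, map_add, map_add, map_add, add_add_add_comm, hp, hq]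

theorem taylorHomotopy_mem_component (A : Finset (Fin r)) (p : MvPolynomial (Fin n) k) :
    taylorHomotopy k m (Finsupp.single A p) ∈ (taylor k m).component (A.card + 1) := by
  induction p using MvPolynomial.induction_on' with
  | monomial v c =>
    have hv : v = v + faceMdeg m A - faceMdeg m A := by simp
    have hle : faceMdeg m A ≤ v + faceMdeg m A := le_add_self
    by_cases h : (label m (v + faceMdeg m A)).Nonempty
    · rw [hv, taylorHomotopy_single_of_le m hle h]
      split_ifs with h'
      · exact zero_mem _
      · exact Finsupp.single_mem_supported _ _ (Finset.card_insert_of_notMem h')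
    · have hc : (monomial v c : MvPolynomial (Fin n) k) =
          c • basisMonomials (Fin n) k v := by
        rw [coe_basisMonomials, smul_monomial, smul_eq_mul, mul_one]
      rw [taylorHomotopy, Finsupp.lsum_single, hc, map_smul, Module.Basis.constr_basis, dif_neg h,
        smul_zero]
      exact zero_mem _
  | add p q hp hq =>
    rw [Finsupp.single_add, map_add]
    exact add_mem hp hq

theorem taylor_isFreeResolution {M : Ideal (MvPolynomial (Fin n) k)}
    (hM : M = Ideal.span (Set.range fun i => monomial (m i) (1 : k))) :
    (taylor k m).IsFreeResolution M := by
  refine ⟨fun p hp x hx hdx => ⟨taylorHomotopy k m x, ?_, ?_⟩, ?_⟩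
  · rw [← Finsupp.sum_single x, Finsupp.sum, map_sum]
    refine sum_mem fun A hA => ?_
    have : A.card = p := hx hA
    rw [← this]
    exact taylorHomotopy_mem_component m A _
  · have : taylorD k m (taylorHomotopy k m x) + taylorHomotopy k m (taylorD k m x) = x := by
      conv_lhs => rw [← Finsupp.sum_single x, Finsupp.sum]
      conv_rhs => rw [← Finsupp.sum_single x, Finsupp.sum]
      simp only [map_sum, ← Finset.sum_add_distrib]
      refine Finset.sum_congr rfl fun A hA => taylorHomotopy_single m ?_ _
      have : A.card = p := hx hA
      exact Finset.card_pos.1 (by omega)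
    have hdx' : taylorD k m x = 0 := hdx
    rwa [hdx', map_zero, add_zero] at this
  · have hx0 : ∀ x ∈ (taylor k m).component 0, x = Finsupp.single ∅ (x ∅) := by
      intro x hx
      ext1 A
      by_cases hA : A = ∅
      · rw [hA, Finsupp.single_eq_same]
      · rw [Finsupp.single_eq_of_ne hA]
        by_contra h
        exact hA (Finset.card_eq_zero.1 (hx (Finsupp.mem_support_iff.2 h)))
    have hd : ∀ i, taylorD k m (Finsupp.single {i} 1) =
        Finsupp.single ∅ (monomial (m i) (1 : k)) := by
      intro i
      rw [taylorD_single, Finset.sum_singleton, faceSign_of_forall_le (by simp)]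
      simp [faceMdeg_empty, show faceMdeg m {i} = m i from Finset.sup_singleton]
    refine ⟨M.mkQ ∘ₗ Finsupp.lapply ∅ ∘ₗ Submodule.subtype _, ?_, ?_, ?_⟩
    · intro s
      obtain ⟨p, rfl⟩ := Ideal.Quotient.mk_surjective s
      refine ⟨⟨Finsupp.single ∅ p, Finsupp.single_mem_supported _ _ (Finset.card_empty (α := Fin r))⟩, ?_⟩
      simp
    · intro x
      have : (M.mkQ ∘ₗ Finsupp.lapply ∅ ∘ₗ Submodule.subtype _) x = 0 ↔ x.1 ∅ ∈ M :=
        Ideal.Quotient.eq_zero_iff_mem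
      rw [this]
      constructor
      · intro hx
        have hle : M ≤ Submodule.comap (Finsupp.lsingle ∅)
            (((taylor k m).component 1).map (taylor k m).d) := by
          rw [hM]
          refine Submodule.span_le.2 ?_
          rintro _ ⟨i, rfl⟩
          exact ⟨Finsupp.single {i} 1,
            Finsupp.single_mem_supported _ _ (Finset.card_singleton i), hd i⟩
        rw [hx0 x.1 x.2]
        exact hle hx
      · rintro ⟨y, hy, hyx⟩
        rw [← hyx]
        rw [MGComplex.component_eq_span] at hy
        have hle : (taylor k m).restrict {A | A.card = 1} ≤
            Submodule.comap (Finsupp.lapply ∅ ∘ₗ (taylor k m).d) M := by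
          refine Submodule.span_le.2 ?_
          rintro _ ⟨A, hA, rfl⟩
          obtain ⟨i, rfl⟩ := Finset.card_eq_one.1 hA
          change taylorD k m (Finsupp.single {i} 1) ∅ ∈ M
          rw [hd, Finsupp.single_eq_same, hM]
          exact Ideal.subset_span ⟨i, rfl⟩
        exact hle hy
    · intro u x hx
      refine ⟨coeff u (x.1 ∅), ?_⟩
      change Ideal.Quotient.mk M (x.1 ∅) = _
      congr 1
      ext v
      rw [coeff_monomial]
      split_ifs with h
      · rw [h]
      · by_contra hv
        have := hx ∅ v (mem_support_iff.2 hv)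
        exact h (this.symm.trans (by simp [taylor, faceMdeg_empty]))

end Taylor

/-! ### Combinatorics of the Scarf complex -/

section Scarf

variable {n r : ℕ} {m : Fin r → (Fin n →₀ ℕ)}

theorem subset_label_faceMdeg (m : Fin r → (Fin n →₀ ℕ)) (A : Finset (Fin r)) :
    A ⊆ label m (faceMdeg m A) :=
  (faceMdeg_le_iff m).1 le_rfl

theorem faceMdeg_label (m : Fin r → (Fin n →₀ ℕ)) (A : Finset (Fin r)) :
    faceMdeg m (label m (faceMdeg m A)) = faceMdeg m A :=
  le_antisymm ((faceMdeg_le_iff m).2 subset_rfl) (Finset.sup_mono (subset_label_faceMdeg m A))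

theorem faceMdeg_insert (m : Fin r → (Fin n →₀ ℕ)) (i : Fin r) (A : Finset (Fin r)) :
    faceMdeg m (insert i A) = m i ⊔ faceMdeg m A :=
  Finset.sup_insert

/-- The label of the multidegree of a face is itself a face of that multidegree, so uniqueness makes
the two faces equal. -/
theorem mem_scarfComplex_iff {A : Finset (Fin r)} :
    A ∈ scarfComplex m ↔ ∀ B, faceMdeg m B = faceMdeg m A → B = A := by
  constructor
  · rintro ⟨u, ⟨-, B, rfl, huniq⟩, rfl⟩
    have hB : label m (faceMdeg m B) = B := huniq _ (faceMdeg_label m B)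
    intro C hC
    rw [faceMdeg_label] at hC
    rw [hB]
    exact huniq C hC
  · intro h
    exact ⟨faceMdeg m A, ⟨⟨A, rfl⟩, A, rfl, h⟩, (h _ (faceMdeg_label m A)).symm⟩

theorem label_eq_of_mem_scarfComplex {A : Finset (Fin r)} (hA : A ∈ scarfComplex m) :
    label m (faceMdeg m A) = A :=
  mem_scarfComplex_iff.1 hA _ (faceMdeg_label m A)

/-- Adding `i` to a face with the multidegree of `A \ {i}` gives one with the multidegree of `A`,
hence `A` itself. -/
theorem erase_mem_scarfComplex {A : Finset (Fin r)} (hA : A ∈ scarfComplex m) (i : Fin r) :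
    A.erase i ∈ scarfComplex m := by
  by_cases hi : i ∈ A
  · rw [mem_scarfComplex_iff] at hA ⊢
    intro B hB
    have h : insert i B = A := hA _ (by
      rw [faceMdeg_insert, hB, ← faceMdeg_insert, Finset.insert_erase hi])
    by_cases hiB : i ∈ B
    · rw [Finset.insert_eq_of_mem hiB] at h
      rw [h] at hB
      rw [h, hA _ hB.symm]
    · rw [← h, Finset.erase_insert hiB]
  · rwa [Finset.erase_eq_of_notMem hi]

theorem mem_scarfComplex_of_subset {A B : Finset (Fin r)} (hA : A ∈ scarfComplex m)
    (h : B ⊆ A) : B ∈ scarfComplex m := by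
  rw [← Finset.sdiff_sdiff_eq_self h]
  induction A \ B using Finset.induction_on with
  | empty => simpa
  | insert i s _ ih =>
    rw [Finset.sdiff_insert]
    exact erase_mem_scarfComplex ih i

/-- A face outside the Scarf complex either can be enlarged or can be made smaller without a
change of multidegree. -/
theorem exists_of_notMem_scarfComplex {B : Finset (Fin r)} (hB : B ∉ scarfComplex m) :
    (∃ i ∉ B, m i ≤ faceMdeg m B) ∨ ∃ i ∈ B, faceMdeg m (B.erase i) = faceMdeg m B := by
  rw [mem_scarfComplex_iff] at hB
  push Not at hB
  obtain ⟨C, hC, hne⟩ := hB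
  -- `C` is a second face with the multidegree of `B`: an element of `B \ C` is superfluous in `B`,
  -- and an element of `C \ B` can be added to it.
  by_cases h : C ⊆ B
  · right
    obtain ⟨i, hi, hiC⟩ := Finset.exists_of_ssubset (h.ssubset_of_ne hne)
    refine ⟨i, hi, le_antisymm (faceMdeg_erase_le m B i) ?_⟩
    rw [← hC]
    exact Finset.sup_mono (Finset.subset_erase.2 ⟨h, hiC⟩)
  · left
    obtain ⟨i, hi, hiB⟩ := Finset.not_subset.1 h
    exact ⟨i, hiB, by rw [← hC]; exact Finset.le_sup (f := m) hi⟩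

theorem taylor_isSubcomplex_scarf (k : Type*) [Field k] (m : Fin r → (Fin n →₀ ℕ)) :
    (taylor k m).IsSubcomplex (scarfComplex m) := by
  have : (taylor k m).restrict (scarfComplex m) ≤
      ((taylor k m).restrict (scarfComplex m)).comap (taylor k m).d := by
    refine Submodule.span_le.2 ?_
    rintro _ ⟨A, hA, rfl⟩
    change taylorD k m (Finsupp.single A 1) ∈ (taylor k m).restrict (scarfComplex m)
    rw [taylorD_single]
    refine sum_mem fun i _ => ?_
    rw [MGComplex.single_eq_smul_basisElt (taylor k m)]
    exact Submodule.smul_mem _ _ (Submodule.subset_span ⟨_, erase_mem_scarfComplex hA i, rfl⟩)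
  exact this

end Scarf

/-! ### Taylor submodules and their intersection -/

section TaylorSubmodule

variable {k : Type*} [Field k] {n r : ℕ} {m : Fin r → (Fin n →₀ ℕ)}
  {M : Ideal (MvPolynomial (Fin n) k)}

/-- The submodule spanned by the basis elements that correspond to `F` consists of the elements
without component in `E`. -/
theorem mem_span_symm_inl_iff {G F E : MGComplex k n} (φ : G.Iso (F.directSum E)) {x : G.Mod} :
    x ∈ Submodule.span (MvPolynomial (Fin n) k)
      (Set.range fun j : F.ι => φ.toEquiv.symm ((F.directSum E).basisElt (Sum.inl j))) ↔
      (F.sumEquiv E (φ.toEquiv x)).2 = 0 := by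
  constructor
  · intro hx
    have : Submodule.span (MvPolynomial (Fin n) k)
      (Set.range fun j : F.ι => φ.toEquiv.symm ((F.directSum E).basisElt (Sum.inl j))) ≤
        LinearMap.ker (LinearMap.snd _ _ _ ∘ₗ (F.sumEquiv E).toLinearMap ∘ₗ
          φ.toEquiv.toLinearMap) := by
      refine Submodule.span_le.2 ?_
      rintro _ ⟨j, rfl⟩
      simp [MGComplex.sumEquiv_basisElt_inl]
    exact this hx
  · intro hx
    have h₁ : x = φ.toEquiv.symm ((F.sumEquiv E).symm ((F.sumEquiv E (φ.toEquiv x)).1, 0)) := by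
      rw [LinearEquiv.eq_symm_apply, LinearEquiv.eq_symm_apply, ← hx]
    rw [h₁]
    generalize (F.sumEquiv E (φ.toEquiv x)).1 = y
    induction y using Finsupp.induction_linear with
    | zero =>
      rw [show ((0 : F.Mod), (0 : E.Mod)) = 0 from rfl, map_zero, map_zero]
      exact zero_mem _
    | add f g hf hg =>
      rw [show ((f + g : F.Mod), (0 : E.Mod)) = (f, 0) + (g, 0) by simp, map_add, map_add]
      exact add_mem hf hg
    | single j a =>
      rw [F.single_eq_smul_basisElt,
        show ((a • F.basisElt j : F.Mod), (0 : E.Mod)) = a • (F.basisElt j, 0) by simp, map_smul,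
        map_smul, MGComplex.sumEquiv_symm_basisElt_left]
      exact Submodule.smul_mem _ _ (Submodule.subset_span ⟨j, rfl⟩)

theorem IsTaylorSubmodule.d_mem {N : Submodule (MvPolynomial (Fin n) k) (taylor k m).Mod}
    (hN : IsTaylorSubmodule m M N) {x : (taylor k m).Mod} (hx : x ∈ N) :
    (taylor k m).d x ∈ N := by
  obtain ⟨F, E, φ, -, -, rfl⟩ := hN
  rw [mem_span_symm_inl_iff] at hx ⊢
  rw [φ.comm, MGComplex.sumEquiv_d, hx, map_zero]

theorem isTaylorSubmodule_of_splits
    (hM : M = Ideal.span (Set.range fun i => monomial (m i) (1 : k)))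
    {F E : MGComplex k n} {α : F.Mod →ₗ[MvPolynomial (Fin n) k] (taylor k m).Mod}
    {β : E.Mod →ₗ[MvPolynomial (Fin n) k] (taylor k m).Mod}
    (h : (taylor k m).Splits F E α β) (hE : E.IsTrivial)
    (hF : LinearMap.range F.d ≤
      Ideal.span (Set.range (X : Fin n → MvPolynomial (Fin n) k)) • ⊤) :
    IsTaylorSubmodule m M (Submodule.span _ (Set.range fun j => α (F.basisElt j))) := by
  obtain ⟨φ, hφ⟩ := h.exists_iso
  refine ⟨F, E, φ, ⟨(taylor_isFreeResolution m hM).of_iso φ hE, hF⟩, hE, ?_⟩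
  simp only [hφ]

/-- If the face `B` can be enlarged without a change of multidegree, some Taylor submodule lies in
the submodule spanned by the other faces. -/
theorem exists_isTaylorSubmodule_apply_eq_zero
    (hM : M = Ideal.span (Set.range fun i => monomial (m i) (1 : k)))
    {B : Finset (Fin r)} {i : Fin r} (hi : i ∉ B) (hle : m i ≤ faceMdeg m B) :
    ∃ N, IsTaylorSubmodule m M N ∧ ∀ x ∈ N, x B = 0 := by
  have hdeg : faceMdeg m B = faceMdeg m (insert i B) := by
    rw [faceMdeg_insert, sup_eq_right.2 hle]
  have hd : (taylor k m).d ((taylor k m).basisElt (insert i B)) B =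
      C (faceSign k (insert i B) i) := by
    change taylorD k m (Finsupp.single (insert i B) 1) B = _
    rw [taylorD_single, Finsupp.finsetSum_apply, Finset.sum_eq_single_of_mem i (by simp)]
    · rw [Finset.erase_insert hi, Finsupp.single_eq_same, ← hdeg, one_mul, tsub_self]
      rfl
    · intro j hj hji
      refine Finsupp.single_eq_of_ne fun h => hi ?_
      rw [h]
      simp [hji.symm]
  have hsign : faceSign k (insert i B) i ≠ 0 := pow_ne_zero _ (by simp)
  obtain ⟨F, E, α, β, hs, hE, -, hα⟩ := (taylor k m).exists_splits_pair (i := B)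
    (j := insert i B) (Finset.card_insert_of_notMem hi).symm hdeg hd hsign
  -- Minimizing inside the complement keeps the image in the range of `α`, so the coefficient at `B`
  -- stays zero.
  obtain ⟨F', E', α', β', hs', hE', hF'⟩ := F.exists_splits_minimal
  refine ⟨_, isTaylorSubmodule_of_splits hM (hs.trans hs') (hE.directSum hE') hF', ?_⟩
  have : Submodule.span _ (Set.range fun j => (α ∘ₗ α') (F'.basisElt j)) ≤
      LinearMap.ker (Finsupp.lapply B : (taylor k m).Mod →ₗ[MvPolynomial (Fin n) k] _) := by
    refine Submodule.span_le.2 ?_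
    rintro _ ⟨j, rfl⟩
    exact hα _
  exact fun x hx => this hx

theorem sInf_isTaylorSubmodule_le
    (hM : M = Ideal.span (Set.range fun i => monomial (m i) (1 : k))) :
    sInf {N | IsTaylorSubmodule m M N} ≤ (taylor k m).restrict (scarfComplex m) := by
  have h₁ : ∀ x ∈ sInf {N | IsTaylorSubmodule m M N}, ∀ B : Finset (Fin r), ∀ i ∉ B,
      m i ≤ faceMdeg m B → x B = 0 := by
    intro x hx B i hi hle
    obtain ⟨N, hN, hN0⟩ := exists_isTaylorSubmodule_apply_eq_zero hM hi hle
    exact hN0 x (Submodule.mem_sInf.1 hx N hN)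
  intro x hx
  rw [MGComplex.mem_restrict_iff]
  intro B hB
  rcases exists_of_notMem_scarfComplex hB with ⟨i, hi, hle⟩ | ⟨i, hi, hB'⟩
  · exact h₁ x hx B i hi hle
  -- `B \ {i}` can be enlarged by `i`, so `h₁` applies to `d x` at this face.
  · have hmi : m i ≤ faceMdeg m (B.erase i) := hB' ▸ Finset.le_sup (f := m) hi
    have hdx : (taylor k m).d x ∈ sInf {N | IsTaylorSubmodule m M N} :=
      Submodule.mem_sInf.2 fun N hN => hN.d_mem (Submodule.mem_sInf.1 hx N hN)
    have h0 := h₁ _ hdx (B.erase i) i (Finset.notMem_erase i B) hmi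
    change taylorD k m x (B.erase i) = 0 at h0
    have hsum : taylorD k m x (B.erase i) = x B * C (faceSign k B i) := by
      conv_lhs => rw [← Finsupp.sum_single x]
      rw [Finsupp.sum_fintype _ _ (by simp), map_sum, Finsupp.finsetSum_apply,
        Finset.sum_eq_single B]
      · rw [taylorD_single, Finsupp.finsetSum_apply,
          Finset.sum_eq_single_of_mem i hi]
        · rw [Finsupp.single_eq_same, hB', tsub_self]
          rfl
        · intro j hj hji
          refine Finsupp.single_eq_of_ne fun h => Finset.notMem_erase j B ?_
          rw [← h]
          simp [hj, hji]
      · intro A _ hA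
        rw [taylorD_single, Finsupp.finsetSum_apply]
        refine Finset.sum_eq_zero fun j hj => ?_
        -- Such a face `A ≠ B` does not contain `i`, while `m i` divides its multidegree; hence `x A
        -- = 0` by `h₁`.
        by_cases h : B.erase i = A.erase j
        · have hiA : i ∉ A := by
            intro hiA
            have hij : i = j := by
              by_contra hij
              exact Finset.notMem_erase i B (h ▸ Finset.mem_erase.2 ⟨hij, hiA⟩)
            subst hij
            exact hA (by rw [← Finset.insert_erase hj, ← h, Finset.insert_erase hi])
          rw [h₁ x hx A i hiA (hmi.trans (h ▸ faceMdeg_erase_le m A j)), zero_mul,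
            Finsupp.single_zero]
          rfl
        · exact Finsupp.single_eq_of_ne h
      · simp
    rw [hsum] at h0
    exact (mul_eq_zero.1 h0).resolve_right fun h =>
      pow_ne_zero (M₀ := k) _ (by simp) (C_eq_zero.1 h)

/-- The preimage of a basis element under an isomorphism has a coefficient with a constant
term. -/
theorem exists_coeff_zero_ne_zero {G H : MGComplex k n} (φ : G.Iso H) (b : H.ι) :
    ∃ i : G.ι, coeff 0 (φ.toEquiv.symm (H.basisElt b) i) ≠ 0 := by
  by_contra! h
  -- An `S`-linear map preserves the vanishing of all constant terms, which fails for a basis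
  -- element.
  have key : ∀ y : G.Mod, (∀ i, constantCoeff (y i) = 0) →
      ∀ l, constantCoeff (φ.toEquiv y l) = 0 := by
    intro y hy l
    rw [← Finsupp.sum_single y, Finsupp.sum, map_sum, Finsupp.finsetSum_apply, map_sum]
    refine Finset.sum_eq_zero fun i _ => ?_
    rw [G.single_eq_smul_basisElt, map_smul, Finsupp.smul_apply, smul_eq_mul, map_mul, hy,
      zero_mul]
  have := key (φ.toEquiv.symm (H.basisElt b)) h b
  rw [LinearEquiv.apply_symm_apply] at this
  simp [MGComplex.basisElt] at this

theorem basisElt_mem_of_mem_scarfComplex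
    {N : Submodule (MvPolynomial (Fin n) k) (taylor k m).Mod}
    (hN : IsTaylorSubmodule m M N) {A : Finset (Fin r)} (hA : A ∈ scarfComplex m) :
    (taylor k m).basisElt A ∈ N := by
  obtain ⟨F, E, φ, -, ⟨κ, e, he⟩, rfl⟩ := hN
  have hface : ∀ b : E.ι, ∃ B : Finset (Fin r), B.card = E.hdeg b ∧ faceMdeg m B = E.mdeg b := by
    intro b
    obtain ⟨B, hB⟩ := exists_coeff_zero_ne_zero φ (Sum.inr b)
    obtain ⟨h₁, h₂⟩ := φ.isHomogMap.symm (Sum.inr b) B 0 (mem_support_iff.2 hB)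
    exact ⟨B, h₁, by rw [← zero_add (faceMdeg m B)]; exact h₂⟩
  -- The two faces supplied by a pair of `E` would be subfaces of `A` of equal multidegree, hence
  -- one Scarf face with two cardinalities.
  have hE : ∀ b : E.ι, ¬ E.mdeg b ≤ faceMdeg m A := by
    have hpair : ∀ a, E.hdeg (e (Sum.inl a)) + 1 = E.hdeg (e (Sum.inr a)) ∧
        E.mdeg (e (Sum.inl a)) = E.mdeg (e (Sum.inr a)) := by
      intro a
      have := E.d_homogeneous (e (Sum.inr a)) (e (Sum.inl a)) 0 (by
        have := (he a).1
        rw [MGComplex.basisElt] at this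
        rw [this]
        simp [MGComplex.basisElt])
      simpa using this
    have hmain : ∀ a, ¬ E.mdeg (e (Sum.inr a)) ≤ faceMdeg m A := by
      intro a hle
      obtain ⟨B, hB, hBm⟩ := hface (e (Sum.inr a))
      obtain ⟨B', hB', hBm'⟩ := hface (e (Sum.inl a))
      have hBA : B ⊆ A := by
        rw [← label_eq_of_mem_scarfComplex hA, ← faceMdeg_le_iff, hBm]
        exact hle
      have : B' = B := mem_scarfComplex_iff.1 (mem_scarfComplex_of_subset hA hBA) B' (by
        rw [hBm, hBm', (hpair a).2])
      have h := (hpair a).1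
      rw [← hB, ← hB', this] at h
      omega
    intro b
    obtain ⟨a | a, rfl⟩ := e.surjective b
    · rw [(hpair a).2]
      exact hmain a
    · exact hmain a
  rw [mem_span_symm_inl_iff]
  ext1 b
  rw [MGComplex.sumEquiv_snd_apply]
  by_contra hne
  obtain ⟨v, hv⟩ := MvPolynomial.support_nonempty.2 hne
  -- A nonzero component at `b` would make its multidegree divide that of `A`.
  have h := (φ.isMultigraded A (Sum.inr b) v hv : v + E.mdeg b = faceMdeg m A)
  exact hE b (le_add_self.trans h.le)

end TaylorSubmodule

end MonomialResolution

theorem mainTheorem8 {k : Type*} [Field k] {n r : ℕ} (m : Fin r → (Fin n →₀ ℕ))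
    (M : Ideal (MvPolynomial (Fin n) k)) (hM : MonomialResolution.MinimallyGenerates m M) :
    (MonomialResolution.taylor k m).IsSubcomplex (MonomialResolution.scarfComplex m) ∧
    sInf {N | MonomialResolution.IsTaylorSubmodule m M N} =
      (MonomialResolution.taylor k m).restrict (MonomialResolution.scarfComplex m) := by
  refine ⟨MonomialResolution.taylor_isSubcomplex_scarf k m,
    le_antisymm (MonomialResolution.sInf_isTaylorSubmodule_le hM.1) ?_⟩
  refine le_sInf fun N hN => Submodule.span_le.2 ?_
  rintro _ ⟨A, hA, rfl⟩
  exact MonomialResolution.basisElt_mem_of_mem_scarfComplex hN hA
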